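/- Let $N\ge 5$ be an integer and $-2<\gamma\le 0$. Let $\mathcal D^{2,2}_{0,\gamma}(\mathbb R^N)$ denote the completion of $C_0^\infty(\mathbb R^N)$ (real-valued smooth functions with compact support) with respect to the norm $\big(\int_{\mathbb R^N}|x|^{-\gamma}|\Delta u|^2\,dx\big)^{1/2}$, realised as a space of functions modulo equality almost everywhere: it consists of all $u\in L^1_{\rm loc}(\mathbb R^N)$ that are limits in $L^1_{\rm loc}(\mathbb R^N)$ of sequences in $C_0^\infty(\mathbb R^N)$ which are Cauchy in this norm. Every $u\in\mathcal D^{2,2}_{0,\gamma}(\mathbb R^N)$ has a weak gradient $\nabla u$ and a weak Laplacian $\Delta u$ (both locally integrable), the three integrals below are finite, and $$\int_{\mathbb R^N}\frac{|\Delta u|^2}{|x|^{\gamma}}\,dx+\Big(\frac{N-4-\gamma}{2}\Big)^4\int_{\mathbb R^N}\frac{|u|^2}{|x|^{\gamma+4}}\,dx\ \ge\ \frac{N^2-4N+8+\gamma^2+4\gamma}{2}\int_{\mathbb R^N}\frac{|\nabla u|^2}{|x|^{\gamma+2}}\,dx .$$ The inequality is strict unless $u=0$ almost everywhere. The constant $\frac{N^2-4N+8+\gamma^2+4\gamma}{2}$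 is sharp: $$\frac{N^2-4N+8+\gamma^2+4\gamma}{2}=\inf_{u}\frac{\int_{\mathbb R^N}|x|^{-\gamma}|\Delta u|^2\,dx+\big(\frac{N-4-\gamma}{2}\big)^4\int_{\mathbb R^N}|x|^{-\gamma-4}|u|^2\,dx}{\int_{\mathbb R^N}|x|^{-\gamma-2}|\nabla u|^2\,dx},$$ where the infimum may be taken either over $u\in\mathcal D^{2,2}_{0,\gamma}(\mathbb R^N)\setminus\{0\}$ or over $u\in C_0^\infty(\mathbb R^N)\setminus\{0\}$. -/

import Mathlib

open MeasureTheory Filter Topology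
open scoped ContDiff

noncomputable section

/-- The Euclidean space `ℝ^N`. -/
abbrev RN (N : ℕ) : Type := EuclideanSpace ℝ (Fin N)

/-- `φ ∈ C₀^∞(ℝ^N)`: real valued, smooth, with compact support (which may contain the origin). -/
def IsTestFun {N : ℕ} (φ : RN N → ℝ) : Prop :=
  ContDiff ℝ ∞ φ ∧ HasCompactSupport φ

/-- `G` is the weak gradient of `u` on `ℝ^N`: `∫ u ∂_v φ = - ∫ ⟨G, v⟩ φ` for all directions `v` and
all test functions `φ`. -/
def HasWeakGradient {N : ℕ} (u : RN N → ℝ) (G : RN N → RN N) : Prop :=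
  LocallyIntegrable u ∧ LocallyIntegrable G ∧
    ∀ φ : RN N → ℝ, IsTestFun φ → ∀ v : RN N,
      ∫ x, u x * fderiv ℝ φ x v = -∫ x, inner ℝ (G x) v * φ x

/-- `L` is the weak Laplacian of `u` on `ℝ^N`: `∫ u Δφ = ∫ L φ` for all test functions `φ`. -/
def HasWeakLaplacian {N : ℕ} (u L : RN N → ℝ) : Prop :=
  LocallyIntegrable u ∧ LocallyIntegrable L ∧
    ∀ φ : RN N → ℝ, IsTestFun φ →
      ∫ x, u x * Laplacian.laplacian φ x = ∫ x, L x * φ x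

/-- The norm `(∫ |x|^{-γ} |Δφ|² dx)^{1/2}` of a test function. -/
def weightedLaplacianNorm {N : ℕ} (γ : ℝ) (φ : RN N → ℝ) : ℝ :=
  √(∫ x, ‖x‖ ^ (-γ) * (Laplacian.laplacian φ x) ^ 2)

/-- `u ∈ 𝒟^{2,2}_{0,γ}(ℝ^N)`, the completion of `C₀^∞(ℝ^N)` in `weightedLaplacianNorm γ`, realised
as a space of locally integrable functions (up to equality a.e.): the `L¹_loc` limits of those
sequences of test functions which are Cauchy in this norm. -/
def MemD22 {N : ℕ} (γ : ℝ) (u : RN N → ℝ) : Prop :=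
  LocallyIntegrable u ∧
    ∃ φ : ℕ → RN N → ℝ, (∀ n, IsTestFun (φ n)) ∧
      (∀ ε > 0, ∃ n₀, ∀ m ≥ n₀, ∀ n ≥ n₀, weightedLaplacianNorm γ (φ m - φ n) < ε) ∧
      ∀ K : Set (RN N), IsCompact K →
        Tendsto (fun n => ∫⁻ x in K, ‖φ n x - u x‖ₑ) atTop (𝓝 0)

/-- `∫ |x|^{-γ} |Δu|² dx`, where `L` is the Laplacian of `u`. -/
def rellichEnergy {N : ℕ} (γ : ℝ) (L : RN N → ℝ) : ℝ :=
  ∫ x, ‖x‖ ^ (-γ) * (L x) ^ 2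

/-- `∫ |x|^{-γ-2} |∇u|² dx`, where `G` is the gradient of `u`. -/
def gradientEnergy {N : ℕ} (γ : ℝ) (G : RN N → RN N) : ℝ :=
  ∫ x, ‖x‖ ^ (-γ - 2) * ‖G x‖ ^ 2

/-- `∫ |x|^{-γ-4} |u|² dx`. -/
def hardyEnergy {N : ℕ} (γ : ℝ) (u : RN N → ℝ) : ℝ :=
  ∫ x, ‖x‖ ^ (-γ - 4) * (u x) ^ 2

/-- `∫ |x|^{-γ} |Δu|² dx + ((N-4-γ)/2)⁴ ∫ |x|^{-γ-4} |u|² dx`. -/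
def hardyRellichSum {N : ℕ} (γ : ℝ) (u L : RN N → ℝ) : ℝ :=
  rellichEnergy γ L + (((N : ℝ) - 4 - γ) / 2) ^ 4 * hardyEnergy γ u

/-- The constant `(N² - 4N + 8 + γ² + 4γ)/2`. -/
def hardyRellichConst (N : ℕ) (γ : ℝ) : ℝ :=
  ((N : ℝ) ^ 2 - 4 * N + 8 + γ ^ 2 + 4 * γ) / 2

end

/-!
Put `a = (N - 4 - γ) / 2` and `b = N - 2 - a = (N + γ) / 2`, so that `b - a = 2 + γ` and the
constant of the inequality is `a² + b²`. For a test function `φ = |x|^{-a} v` with support away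
from the origin, the three energies become integrals against the scale invariant measure
`|x|^{-N} dx`. Let `E = x · ∇` be the Euler operator, `D` the tangential gradient and `Λ` the
Laplacian on spheres. Then `|x|² Δ φ = |x|^{-a} (E² + (b - a) E - a b + Λ) v`. As `E` is
skew-adjoint for this measure and commutes with `D`, expanding the squares shows that the
difference of the two sides of the inequality is
`‖E² v‖² + 2 ‖D E v‖² + ‖Λ v‖² - (2 + γ)² ‖D v‖²` (`hardyRellich_identity`). The last two terms
together are nonnegative, since `(2 + γ)² ≤ 4 ≤ N - 1` and `‖Λ v‖² ≥ (N - 1) ‖D v‖²`; the latter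
is the spectral gap of the sphere, obtained here from the Bochner formula
(`PolarCalculus.spectral_gap`). All of this is algebra with derivations, and it is carried out in
an abstract structure, `PolarCalculus`, of which the smooth functions on `ℝ^N \ {0}` are an
instance.

So the deficit is at least `‖E² v‖²`. This in turn bounds a fixed weighted `L²` norm of `v`, by
`‖E v‖² ≤ ‖v‖ ‖E² v‖` and one more integration by parts
(`IsPuncturedTestFun.localisedHardyEnergy_le`).

These inequalities only involve the weighted `L²` norms of the triple `(Δφ, ∇φ, φ)`, so they pass to
the closure `energyClosure` of such triples. That closure contains the triples of all test
functions, by cutting off near the origin (`IsTestFun.mem_energyClosure`), and the triples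
`(Δu, ∇u, u)` of all `u` in the completion, because the Rellich inequality bounds the other two
norms by that of the Laplacian (`MemD22.exists_represents`). If equality holds for `u`, the deficits
of an approximating sequence tend to zero, hence so do their localised norms, and `u = 0`.

For sharpness take `v = θ(log |x| / T)` with a bump function `θ`. Only the term `‖E² v‖²` of the
deficit is present; it is of order `T⁻³`, while the gradient energy is of order `T`
(`PuncturedSmooth.exists_nearly_optimal`).
-/

noncomputable section

variable {N : ℕ}

/-! ### Calculus in polar coordinates, algebraically -/

/-- The rules of calculus on `ℝⁿ \ {0}` with respect to the scale invariant measure `|x|⁻ⁿ dx`, in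
algebraic form: `A` plays the role of the smooth functions on `ℝⁿ \ {0}`, `F i` of `|x| ∂ᵢ`, `dir i`
of `xᵢ / |x|`, the ideal `S` of the functions with compact support in `ℝⁿ \ {0}`, and `I` of
integration against `|x|⁻ⁿ dx`. Only the values of `I` on `S` carry meaning; `I` is taken to be
linear on all of `A` so that no side conditions arise when sums are split. -/
structure PolarCalculus (A : Type*) [CommRing A] [Algebra ℝ A] (n : ℕ) where
  F : Fin n → Derivation ℝ A A
  dir : Fin n → A
  S : Ideal A
  I : A →ₗ[ℝ] ℝ
  sum_dir_mul_dir : ∑ i, dir i * dir i = 1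
  F_dir : ∀ i j, F i (dir j) = (if i = j then 1 else 0) - dir i * dir j
  F_comm : ∀ i j f, F i (F j f) - F j (F i f) = dir i * F j f - dir j * F i f
  F_mem : ∀ i f, f ∈ S → F i f ∈ S
  I_F : ∀ i f, f ∈ S → I (F i f) = ((n : ℝ) - 1) * I (dir i * f)
  I_mul_self_nonneg : ∀ f ∈ S, 0 ≤ I (f * f)

namespace PolarCalculus

variable {A : Type*} [CommRing A] [Algebra ℝ A] {n : ℕ} (P : PolarCalculus A n)

/-- The Euler operator `x · ∇`, the radial derivative in logarithmic scale. -/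
def E : Derivation ℝ A A := ∑ i, P.dir i • P.F i

/-- The components of the tangential gradient on spheres, `|x| ∂ᵢ - (xᵢ / |x|) x · ∇`. -/
def D (i : Fin n) : Derivation ℝ A A := P.F i - P.dir i • P.E

/-- The Laplace-Beltrami operator on spheres, as the sum of the squares of the tangential
derivatives. -/
def Λ (f : A) : A := ∑ i, P.D i (P.D i f)

lemma E_apply (f : A) : P.E f = ∑ i, P.dir i * P.F i f := by
  have h := congrFun (map_sum (Derivation.coeFnAddMonoidHom (R := ℝ) (A := A) (M := A))
    (fun i => P.dir i • P.F i) Finset.univ) f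
  rw [Finset.sum_apply] at h
  exact h

lemma D_apply (i : Fin n) (f : A) : P.D i f = P.F i f - P.dir i * P.E f := by
  simp [D]

lemma F_eq (i : Fin n) (f : A) : P.F i f = P.D i f + P.dir i * P.E f := by
  simp [D_apply]

lemma E_dir (j : Fin n) : P.E (P.dir j) = 0 := by
  simp only [E_apply, F_dir, mul_sub, Finset.sum_sub_distrib, ← mul_assoc, ← Finset.sum_mul,
    sum_dir_mul_dir]
  simp

lemma D_dir (i j : Fin n) : P.D i (P.dir j) = (if i = j then 1 else 0) - P.dir i * P.dir j := by
  simp [D_apply, E_dir, F_dir]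

lemma sum_D_dir : ∑ i, P.D i (P.dir i) = (n : A) - 1 := by
  simp [D_dir, sum_dir_mul_dir]

lemma sum_dir_mul_D (f : A) : ∑ i, P.dir i * P.D i f = 0 := by
  simp only [D_apply, mul_sub, Finset.sum_sub_distrib, ← mul_assoc, ← Finset.sum_mul,
    sum_dir_mul_dir, ← E_apply]
  simp

lemma E_F_comm (j : Fin n) (f : A) : P.E (P.F j f) = P.F j (P.E f) := by
  have h : ∀ i, P.F j (P.dir i * P.F i f) = P.dir i * P.F i (P.F j f)
      - (P.dir i * P.dir i) * P.F j f + (if j = i then 1 else 0) * P.F i f := by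
    intro i
    rw [Derivation.leibniz, F_dir, smul_eq_mul, smul_eq_mul]
    linear_combination -(P.dir i) * P.F_comm i j f
  rw [E_apply, E_apply, map_sum, Finset.sum_congr rfl fun i _ => h i]
  simp [Finset.sum_add_distrib, ← Finset.sum_mul, sum_dir_mul_dir]

lemma E_D_comm (j : Fin n) (f : A) : P.E (P.D j f) = P.D j (P.E f) := by
  simp [D_apply, E_F_comm, E_dir]

lemma D_D_comm (i j : Fin n) (f : A) :
    P.D i (P.D j f) - P.D j (P.D i f) = P.dir i * P.D j f - P.dir j * P.D i f := by
  have h := P.F_comm i j f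
  have hi : P.D i (P.D j f) = P.F i (P.F j f) - P.dir i * P.F j (P.E f)
      - ((if i = j then 1 else 0) - P.dir i * P.dir j) * P.E f - P.dir j * P.F i (P.E f)
      + P.dir j * P.dir i * P.E (P.E f) := by
    rw [P.D_apply j, map_sub, Derivation.leibniz, D_dir, P.D_apply i (P.F j f), E_F_comm,
      P.D_apply i (P.E f)]
    simp only [smul_eq_mul]
    ring
  have hj : P.D j (P.D i f) = P.F j (P.F i f) - P.dir j * P.F i (P.E f)
      - ((if i = j then 1 else 0) - P.dir i * P.dir j) * P.E f - P.dir i * P.F j (P.E f)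
      + P.dir j * P.dir i * P.E (P.E f) := by
    rw [P.D_apply i, map_sub, Derivation.leibniz, D_dir, P.D_apply j (P.F i f), E_F_comm,
      P.D_apply j (P.E f)]
    simp only [smul_eq_mul, eq_comm (a := j)]
    ring
  rw [hi, hj, P.D_apply i, P.D_apply j]
  linear_combination h

lemma E_mem {f : A} (hf : f ∈ P.S) : P.E f ∈ P.S := by
  rw [E_apply]
  exact P.S.sum_mem fun i _ => P.S.mul_mem_left _ (P.F_mem i f hf)

lemma D_mem (i : Fin n) {f : A} (hf : f ∈ P.S) : P.D i f ∈ P.S := by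
  rw [D_apply]
  exact P.S.sub_mem (P.F_mem i f hf) (P.S.mul_mem_left _ (P.E_mem hf))

lemma Λ_mem {f : A} (hf : f ∈ P.S) : P.Λ f ∈ P.S :=
  P.S.sum_mem fun i _ => P.D_mem i (P.D_mem i hf)

/-- `|x|² Δ` in polar coordinates: the left-hand side is `|x|² Δ f`, since
`|x| ∂ᵢ (|x| ∂ᵢ f) = |x|² ∂ᵢ² f + xᵢ ∂ᵢ f`. -/
lemma sum_F_F_sub_E (f : A) :
    ∑ i, P.F i (P.F i f) - P.E f = P.E (P.E f) + ((n : A) - 2) * P.E f + P.Λ f := by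
  have h : ∀ i, P.F i (P.F i f) = P.D i (P.D i f) + P.D i (P.dir i) * P.E f
      + 2 * (P.dir i * P.D i (P.E f)) + (P.dir i * P.dir i) * P.E (P.E f) := by
    intro i
    rw [P.F_eq i (P.F i f), E_F_comm, P.F_eq i f, P.F_eq i (P.E f), map_add, Derivation.leibniz]
    simp only [smul_eq_mul]
    ring
  simp only [h, Finset.sum_add_distrib, ← Finset.mul_sum, ← Finset.sum_mul, sum_D_dir,
    sum_dir_mul_D, sum_dir_mul_dir, Λ]
  ring

lemma sum_F_mul_F (f : A) :
    ∑ i, P.F i f * P.F i f = P.E f * P.E f + ∑ i, P.D i f * P.D i f := by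
  have h : ∀ i, P.F i f * P.F i f = P.D i f * P.D i f
      + 2 * P.E f * (P.dir i * P.D i f) + (P.dir i * P.dir i) * (P.E f * P.E f) := by
    intro i
    rw [P.F_eq i f]
    ring
  simp only [h, Finset.sum_add_distrib, ← Finset.mul_sum, ← Finset.sum_mul, sum_dir_mul_D,
    sum_dir_mul_dir]
  ring

lemma I_E {f : A} (hf : f ∈ P.S) : P.I (P.E f) = 0 := by
  have h : ∀ i, P.dir i * P.F i f = P.F i (P.dir i * f) - (1 - P.dir i * P.dir i) * f := by
    intro i
    rw [Derivation.leibniz, F_dir, if_pos rfl]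
    simp only [smul_eq_mul]
    ring
  have hs : ∑ i, (1 - P.dir i * P.dir i) * f = ((n : ℝ) - 1) • f := by
    rw [← Finset.sum_mul, Finset.sum_sub_distrib, sum_dir_mul_dir]
    simp [Algebra.smul_def]
  have hs' : ∑ i, P.dir i * (P.dir i * f) = f := by
    simp only [← mul_assoc, ← Finset.sum_mul, sum_dir_mul_dir, one_mul]
  simp only [E_apply, h, Finset.sum_sub_distrib, hs, map_sub, map_sum]
  rw [Finset.sum_congr rfl fun i _ => P.I_F i _ (P.S.mul_mem_left _ hf), ← Finset.mul_sum,
    ← map_sum, hs', map_smul, smul_eq_mul, sub_self]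

lemma I_D (i : Fin n) {f : A} (hf : f ∈ P.S) :
    P.I (P.D i f) = ((n : ℝ) - 1) * P.I (P.dir i * f) := by
  have h : P.dir i * P.E f = P.E (P.dir i * f) := by simp [Derivation.leibniz, E_dir]
  rw [D_apply, map_sub, P.I_F i f hf, h, P.I_E (P.S.mul_mem_left _ hf), sub_zero]

lemma I_mul_E {f g : A} (hf : f ∈ P.S) : P.I (f * P.E g) = -P.I (P.E f * g) := by
  have h := P.I_E (P.S.mul_mem_right g hf)
  rw [Derivation.leibniz, smul_eq_mul, smul_eq_mul, map_add, mul_comm g] at h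
  linarith

/-- Green's formula on spheres. -/
lemma I_mul_Λ {f g : A} (hf : f ∈ P.S) :
    P.I (f * P.Λ g) = -∑ i, P.I (P.D i f * P.D i g) := by
  have h : ∀ i, f * P.D i (P.D i g) = P.D i (f * P.D i g) - P.D i f * P.D i g := by
    intro i
    rw [Derivation.leibniz, smul_eq_mul, smul_eq_mul]
    ring
  have h0 : ∑ i, P.dir i * (f * P.D i g) = 0 := by
    simp only [mul_left_comm _ f, ← Finset.mul_sum, sum_dir_mul_D, mul_zero]
  rw [Λ, Finset.mul_sum, map_sum]
  simp only [h, map_sub, Finset.sum_sub_distrib]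
  rw [Finset.sum_congr rfl fun i _ => P.I_D i (P.S.mul_mem_right _ hf), ← Finset.mul_sum,
    ← map_sum, h0]
  simp

/-- Tangential derivatives do not commute with the spherical Laplacian; the first order term is the
Ricci curvature of the sphere. -/
lemma Λ_D (j : Fin n) (f : A) :
    P.Λ (P.D j f) = P.D j (P.Λ f) + ((n : A) - 3) * P.D j f - 2 * (P.dir j * P.Λ f) := by
  have h : ∀ i, P.D i (P.D i (P.D j f)) = P.D j (P.D i (P.D i f))
      + (P.dir i * P.D j (P.D i f) + P.D j (P.dir i) * P.D i f) - 2 * (P.dir j * P.D i (P.D i f))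
      + P.D i (P.dir i) * P.D j f + (P.dir i * P.D i (P.D j f) + P.D i f * P.D j (P.dir i))
      - 2 * (P.D i (P.dir j) * P.D i f) - P.D j (P.dir i) * P.D i f := by
    intro i
    have h1 := P.D_D_comm i j f
    have h2 := P.D_D_comm i j (P.D i f)
    have h3 : P.D i (P.D j f) = P.D j (P.D i f) + (P.dir i * P.D j f - P.dir j * P.D i f) := by
      rw [← h1]; ring
    have hdir : P.D i (P.dir j) = P.D j (P.dir i) := by
      simp only [D_dir, eq_comm (a := j), mul_comm]
    conv_lhs => rw [h3]
    rw [map_add, map_sub, Derivation.leibniz, Derivation.leibniz]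
    simp only [smul_eq_mul]
    linear_combination h2 + P.D i f * hdir
  have hsum : ∑ i, (P.dir i * P.D i (P.D j f)) = 0 := P.sum_dir_mul_D _
  have hsum' : ∑ i, (P.dir i * P.D j (P.D i f) + P.D j (P.dir i) * P.D i f) = 0 := by
    have := congrArg (P.D j) (P.sum_dir_mul_D f)
    rw [map_sum, map_zero] at this
    rw [← this]
    refine Finset.sum_congr rfl fun i _ => ?_
    rw [Derivation.leibniz]
    simp only [smul_eq_mul]
    ring
  have hP : ∑ i, P.D j (P.dir i) * P.D i f = P.D j f := by
    simp only [D_dir, sub_mul, Finset.sum_sub_distrib, mul_assoc, ← Finset.mul_sum, sum_dir_mul_D]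
    simp
  have hP' : ∑ i, P.D i (P.dir j) * P.D i f = P.D j f := by
    simp only [D_dir, sub_mul, Finset.sum_sub_distrib, mul_comm _ (P.dir j), mul_assoc,
      ← Finset.mul_sum, sum_dir_mul_D]
    simp
  have hP'' : ∑ i, P.D i f * P.D j (P.dir i) = P.D j f := by
    rw [← hP]; exact Finset.sum_congr rfl fun i _ => mul_comm _ _
  simp only [Λ, h, Finset.sum_add_distrib, Finset.sum_sub_distrib, ← Finset.mul_sum,
    ← Finset.sum_mul, sum_D_dir, map_sum, hP, hP', hP'', hsum]
  rw [Finset.sum_add_distrib] at hsum'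
  linear_combination hsum' - hP

/-- The integrated Bochner formula. -/
lemma sum_I_D_D {f : A} (hf : f ∈ P.S) :
    ∑ j, ∑ i, P.I (P.D i (P.D j f) * P.D i (P.D j f)) =
      P.I (P.Λ f * P.Λ f) - ((n : ℝ) - 3) * ∑ j, P.I (P.D j f * P.D j f) := by
  have h : ∀ j, ∑ i, P.I (P.D i (P.D j f) * P.D i (P.D j f)) =
      2 * P.I (P.dir j * P.D j f * P.Λ f) - P.I (P.D j (P.Λ f) * P.D j f)
        - ((n : ℝ) - 3) * P.I (P.D j f * P.D j f) := by
    intro j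
    have h1 : P.D j f * P.Λ (P.D j f) = P.D j (P.Λ f) * P.D j f
        + ((n : ℝ) - 3) • (P.D j f * P.D j f) - (2 : ℝ) • (P.dir j * P.D j f * P.Λ f) := by
      rw [Λ_D]
      simp only [Algebra.smul_def, map_sub, map_natCast, map_ofNat]
      ring
    rw [← neg_eq_iff_eq_neg.mpr (P.I_mul_Λ (P.D_mem j hf)), h1]
    simp only [map_sub, map_add, map_smul, smul_eq_mul]
    ring
  have h0 : ∑ j, P.dir j * P.D j f * P.Λ f = 0 := by
    rw [← Finset.sum_mul, sum_dir_mul_D, zero_mul]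
  simp only [h, Finset.sum_sub_distrib, ← Finset.mul_sum, ← map_sum, h0]
  rw [P.I_mul_Λ (P.Λ_mem hf), map_sum]
  simp

/-- The spectral gap `n - 1` of the unit sphere of `ℝⁿ`, in the form `‖Λ f‖² ≥ (n - 1) ‖∇ f‖²`. As
in the Lichnerowicz argument, it follows from the Bochner formula and from the nonnegativity of the
square of the trace-free Hessian; `K j i` below is `n - 1` times that Hessian. -/
lemma spectral_gap (hn : 3 ≤ n) {f : A} (hf : f ∈ P.S) :
    ((n : ℝ) - 1) * ∑ i, P.I (P.D i f * P.D i f) ≤ P.I (P.Λ f * P.Λ f) := by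
  set K : Fin n → Fin n → A := fun j i =>
    ((n : A) - 1) * (P.D i (P.D j f) + P.D i f * P.dir j) - P.D i (P.dir j) * P.Λ f with hK
  have hKS : ∀ j i, K j i ∈ P.S := fun j i =>
    P.S.sub_mem (P.S.mul_mem_left _ (P.S.add_mem (P.D_mem _ (P.D_mem _ hf))
      (P.S.mul_mem_right _ (P.D_mem _ hf)))) (P.S.mul_mem_left _ (P.Λ_mem hf))
  have hpos : 0 ≤ ∑ j, ∑ i, P.I (K j i * K j i) :=
    Finset.sum_nonneg fun j _ => Finset.sum_nonneg fun i _ => P.I_mul_self_nonneg _ (hKS j i)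
  have hHdir : ∀ i, ∑ j, P.dir j * P.D i (P.D j f) = - P.D i f := by
    intro i
    have h := congrArg (P.D i) (P.sum_dir_mul_D f)
    rw [map_sum, map_zero] at h
    have h' : ∑ j, P.D i (P.dir j) * P.D j f = P.D i f := by
      simp only [D_dir, sub_mul, Finset.sum_sub_distrib, mul_assoc, ← Finset.mul_sum, sum_dir_mul_D]
      simp
    rw [eq_neg_iff_add_eq_zero, ← h]
    conv_lhs => rw [← h']
    rw [← Finset.sum_add_distrib]
    refine Finset.sum_congr rfl fun j _ => ?_
    rw [Derivation.leibniz]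
    simp only [smul_eq_mul]
    ring
  have hdirP : ∀ i, ∑ j, P.dir j * P.D i (P.dir j) = 0 := by
    intro i
    simp only [D_dir, mul_sub, Finset.sum_sub_distrib, mul_left_comm _ (P.dir i), ← Finset.mul_sum,
      sum_dir_mul_dir]
    simp
  have hPP : ∀ i, ∑ j, P.D i (P.dir j) * P.D i (P.dir j) = P.D i (P.dir i) := by
    intro i
    have h : ∀ j, P.D i (P.dir j) * P.D i (P.dir j) =
        (if i = j then P.D i (P.dir j) else 0) - P.dir i * (P.dir j * P.D i (P.dir j)) := by
      intro j
      conv_lhs => enter [1]; rw [D_dir]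
      split_ifs <;> ring
    simp only [h, Finset.sum_sub_distrib, ← Finset.mul_sum, hdirP]
    simp
  have hPH : ∑ i, ∑ j, P.D i (P.dir j) * P.D i (P.D j f) = P.Λ f := by
    have h : ∀ i j, P.D i (P.dir j) * P.D i (P.D j f) =
        (if i = j then P.D i (P.D j f) else 0) - P.dir i * (P.dir j * P.D i (P.D j f)) := by
      intro i j
      rw [D_dir]
      split_ifs <;> ring
    simp only [h, Finset.sum_sub_distrib, ← Finset.mul_sum, hHdir, mul_neg, Finset.sum_neg_distrib,
      sum_dir_mul_D]
    simp [Λ]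
  have hsum : ∑ i, ∑ j, K j i * K j i = (((n : ℝ) - 1) ^ 2) •
      ((∑ i, ∑ j, P.D i (P.D j f) * P.D i (P.D j f)) - ∑ i, P.D i f * P.D i f)
      - ((n : ℝ) - 1) • (P.Λ f * P.Λ f) := by
    have h : ∀ i j, K j i * K j i =
        ((n : A) - 1) ^ 2 * (P.D i (P.D j f) * P.D i (P.D j f))
        + 2 * ((n : A) - 1) ^ 2 * (P.D i f * (P.dir j * P.D i (P.D j f)))
        + ((n : A) - 1) ^ 2 * ((P.D i f * P.D i f) * (P.dir j * P.dir j))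
        - 2 * ((n : A) - 1) * P.Λ f * (P.D i (P.dir j) * P.D i (P.D j f))
        - 2 * ((n : A) - 1) * P.Λ f * (P.D i f * (P.dir j * P.D i (P.dir j)))
        + P.Λ f * P.Λ f * (P.D i (P.dir j) * P.D i (P.dir j)) := by
      intro i j
      simp only [hK]
      ring
    simp only [h, Finset.sum_add_distrib, Finset.sum_sub_distrib, ← Finset.mul_sum, hHdir, hdirP,
      hPP, hPH, sum_dir_mul_dir, sum_D_dir, mul_neg, Finset.sum_neg_distrib, mul_zero,
      Finset.sum_const_zero, mul_one]
    simp only [Algebra.smul_def, map_sub, map_pow, map_natCast, map_one]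
    ring
  rw [Finset.sum_comm] at hpos
  simp only [← map_sum] at hpos
  have hII := P.sum_I_D_D hf
  rw [Finset.sum_comm] at hII
  simp only [← map_sum] at hII
  rw [hsum, map_sub, map_smul, map_smul, map_sub, hII] at hpos
  simp only [smul_eq_mul, ← map_sum] at hpos ⊢
  have hn' : (3 : ℝ) ≤ n := by exact_mod_cast hn
  refine le_of_sub_nonneg (nonneg_of_mul_nonneg_right (a := ((n : ℝ) - 1) * ((n : ℝ) - 2))
    (hpos.trans_eq (by ring)) (by nlinarith))

/-- The weighted `L²` norm of `Δ`, after conjugation by a power of `|x|`. All mixed terms are either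
zero or of a definite sign because `E` is skew-adjoint and commutes with the tangential
derivatives. -/
lemma I_rellich_sq (c d : ℝ) {f : A} (hf : f ∈ P.S) :
    P.I ((P.E (P.E f) + c • P.E f - d • f + P.Λ f) * (P.E (P.E f) + c • P.E f - d • f + P.Λ f)) =
      P.I (P.E (P.E f) * P.E (P.E f)) + (c ^ 2 + 2 * d) * P.I (P.E f * P.E f) + d ^ 2 * P.I (f * f)
      + P.I (P.Λ f * P.Λ f) + 2 * ∑ i, P.I (P.D i (P.E f) * P.D i (P.E f))
      + 2 * d * ∑ i, P.I (P.D i f * P.D i f) := by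
  have hE := P.E_mem hf
  have h01 : P.I (f * P.E f) = 0 := by
    have := P.I_mul_E (g := f) hf
    rw [mul_comm (P.E f)] at this
    linarith
  have h12 : P.I (P.E f * P.E (P.E f)) = 0 := by
    have := P.I_mul_E (g := P.E f) hE
    rw [mul_comm (P.E (P.E f))] at this
    linarith
  have h02 : P.I (f * P.E (P.E f)) = -P.I (P.E f * P.E f) := P.I_mul_E hf
  have h0Λ : P.I (f * P.Λ f) = -∑ i, P.I (P.D i f * P.D i f) := P.I_mul_Λ hf
  have h1Λ : P.I (P.E f * P.Λ f) = 0 := by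
    rw [P.I_mul_Λ hE, neg_eq_zero]
    refine Finset.sum_eq_zero fun i _ => ?_
    have := P.I_mul_E (g := P.D i f) (P.D_mem i hf)
    rw [P.E_D_comm, mul_comm (P.D i f)] at this
    linarith
  have h2Λ : P.I (P.E (P.E f) * P.Λ f) = ∑ i, P.I (P.D i (P.E f) * P.D i (P.E f)) := by
    rw [P.I_mul_Λ (P.E_mem hE), ← Finset.sum_neg_distrib]
    refine Finset.sum_congr rfl fun i _ => ?_
    have := P.I_mul_E (g := P.E f) (P.D_mem i hf)
    rw [← P.E_D_comm i (P.E f), mul_comm, ← P.E_D_comm i f]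
    have h := P.I_mul_E (g := P.E (P.D i f)) (P.D_mem i hf)
    rw [h, neg_neg]
  have h : (P.E (P.E f) + c • P.E f - d • f + P.Λ f) * (P.E (P.E f) + c • P.E f - d • f + P.Λ f) =
      P.E (P.E f) * P.E (P.E f) + c ^ 2 • (P.E f * P.E f) + d ^ 2 • (f * f) + P.Λ f * P.Λ f
      + (2 * c) • (P.E f * P.E (P.E f)) - (2 * d) • (f * P.E (P.E f))
      + (2 : ℝ) • (P.E (P.E f) * P.Λ f) - (2 * c * d) • (f * P.E f)
      + (2 * c) • (P.E f * P.Λ f) - (2 * d) • (f * P.Λ f) := by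
    simp only [Algebra.smul_def, map_mul, map_pow, map_ofNat]
    ring
  rw [h]
  simp only [map_add, map_sub, map_smul, smul_eq_mul, h01, h12, h02, h0Λ, h1Λ, h2Λ]
  ring

/-- The Cauchy-Schwarz inequality for `I`. -/
lemma I_mul_sq_le {f g : A} (hf : f ∈ P.S) (hg : g ∈ P.S) :
    P.I (f * g) ^ 2 ≤ P.I (f * f) * P.I (g * g) := by
  have h : ∀ t : ℝ, 0 ≤ P.I (f * f) * (t * t) + 2 * P.I (f * g) * t + P.I (g * g) := by
    intro t
    have hmem : t • f + g ∈ P.S := by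
      rw [Algebra.smul_def]
      exact P.S.add_mem (P.S.mul_mem_left _ hf) hg
    refine (P.I_mul_self_nonneg _ hmem).trans_eq ?_
    have : (t • f + g) * (t • f + g) = (t * t) • (f * f) + (2 * t) • (f * g) + g * g := by
      simp only [Algebra.smul_def, map_mul, map_ofNat]
      ring
    rw [this]
    simp only [map_add, map_smul, smul_eq_mul]
    ring
  have := discrim_le_zero h
  rw [discrim] at this
  linarith

lemma I_E_sq_sq_le {f : A} (hf : f ∈ P.S) :
    P.I (P.E f * P.E f) ^ 2 ≤ P.I (f * f) * P.I (P.E (P.E f) * P.E (P.E f)) := by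
  have h := P.I_mul_E (g := P.E f) hf
  have := P.I_mul_sq_le hf (P.E_mem (P.E_mem hf))
  rw [h] at this
  linarith

/-- A function `f` with small `‖E² f‖` is locally small: integration by parts bounds the integral of
`E h * f²` by `‖f‖ ‖E f‖`, for any bounded `h`, and `‖E f‖² ≤ ‖f‖ ‖E² f‖`. Boundedness of `h` enters
only through `hh`. -/
lemma I_E_mul_sq_le {f h : A} (hf : f ∈ P.S)
    (hh : P.I (h * f * (h * f)) ≤ P.I (f * f)) :
    P.I (P.E h * (f * f)) ^ 4 ≤
      16 * P.I (f * f) ^ 3 * P.I (P.E (P.E f) * P.E (P.E f)) := by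
  have hhf : h * f ∈ P.S := P.S.mul_mem_left _ hf
  have h1 : P.I (P.E h * (f * f)) = -2 * P.I (h * f * P.E f) := by
    have hd : P.E h * (f * f) = P.E (h * (f * f)) - (2 : ℝ) • (h * f * P.E f) := by
      simp only [Derivation.leibniz, smul_eq_mul, Algebra.smul_def, map_ofNat]
      ring
    rw [hd, map_sub, P.I_E (P.S.mul_mem_left _ (P.S.mul_mem_left _ hf)), map_smul, smul_eq_mul]
    ring
  have h0 := P.I_mul_self_nonneg f hf
  have h0' := P.I_mul_self_nonneg _ (P.E_mem hf)
  have h2 : P.I (h * f * P.E f) ^ 2 ≤ P.I (f * f) * P.I (P.E f * P.E f) :=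
    (P.I_mul_sq_le hhf (P.E_mem hf)).trans (mul_le_mul_of_nonneg_right hh h0')
  have h3 := P.I_E_sq_sq_le hf
  calc P.I (P.E h * (f * f)) ^ 4 = 16 * (P.I (h * f * P.E f) ^ 2) ^ 2 := by rw [h1]; ring
    _ ≤ 16 * (P.I (f * f) * P.I (P.E f * P.E f)) ^ 2 := by gcongr
    _ = 16 * P.I (f * f) ^ 2 * P.I (P.E f * P.E f) ^ 2 := by ring
    _ ≤ 16 * P.I (f * f) ^ 2 * (P.I (f * f) * P.I (P.E (P.E f) * P.E (P.E f))) := by gcongr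
    _ = _ := by ring

/-- A function whose gradient is radial has no tangential derivatives. -/
lemma D_eq_zero_of_radial {f g : A} (h : ∀ i, P.F i f = P.dir i * g) (i : Fin n) :
    P.D i f = 0 := by
  rw [D_apply, E_apply]
  simp only [h, ← mul_assoc, ← Finset.sum_mul, sum_dir_mul_dir, one_mul, sub_self]

lemma E_eq_of_radial {f g : A} (h : ∀ i, P.F i f = P.dir i * g) : P.E f = g := by
  rw [E_apply]
  simp only [h, ← mul_assoc, ← Finset.sum_mul, sum_dir_mul_dir, one_mul]

variable {ρ : A} {s : ℝ}

lemma E_homogeneous_mul (hρ : ∀ i, P.F i ρ = s • (P.dir i * ρ)) (f : A) :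
    P.E (ρ * f) = ρ * (P.E f + s • f) := by
  have h := P.E_eq_of_radial (g := s • ρ) (fun i => by rw [hρ, mul_smul_comm])
  simp only [Derivation.leibniz, h, smul_eq_mul, Algebra.smul_def]
  ring

lemma D_homogeneous_mul (hρ : ∀ i, P.F i ρ = s • (P.dir i * ρ)) (i : Fin n) (f : A) :
    P.D i (ρ * f) = ρ * P.D i f := by
  have h := P.D_eq_zero_of_radial (g := s • ρ) (fun i => by rw [hρ, mul_smul_comm]) i
  simp [Derivation.leibniz, h]

/-- The Laplacian of a product with a radial function `ρ` that is homogeneous of degree `s`. -/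
lemma laplacian_homogeneous_mul (hρ : ∀ i, P.F i ρ = s • (P.dir i * ρ)) (f : A) :
    ∑ i, P.F i (P.F i (ρ * f)) - P.E (ρ * f) =
      ρ * (P.E (P.E f) + ((n : ℝ) - 2 + 2 * s) • P.E f - (-s * (n - 2 + s)) • f + P.Λ f) := by
  rw [sum_F_F_sub_E]
  simp only [Λ, P.E_homogeneous_mul hρ, P.D_homogeneous_mul hρ, map_add, Derivation.map_smul,
    ← Finset.mul_sum]
  simp only [Algebra.smul_def, map_add, map_sub, map_mul, map_ofNat, map_natCast, map_neg]
  ring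

lemma sum_F_homogeneous_mul (hρ : ∀ i, P.F i ρ = s • (P.dir i * ρ)) (f : A) :
    ∑ i, P.F i (ρ * f) * P.F i (ρ * f) =
      ρ * ρ * ((P.E f + s • f) * (P.E f + s • f) + ∑ i, P.D i f * P.D i f) := by
  rw [sum_F_mul_F]
  simp only [P.E_homogeneous_mul hρ, P.D_homogeneous_mul hρ, mul_mul_mul_comm ρ _ ρ,
    ← Finset.mul_sum]
  ring

end PolarCalculus

/-! ### Smooth functions on the punctured space -/

/-- The `i`-th vector of the standard basis. -/
abbrev basisVec (i : Fin N) : RN N := EuclideanSpace.single i 1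

/-- The partial derivative `∂ᵢ f`. -/
def partialDeriv (i : Fin N) (f : RN N → ℝ) (x : RN N) : ℝ := fderiv ℝ f x (basisVec i)

protected lemma ContDiffAt.partialDeriv {f : RN N → ℝ} {x : RN N} (hf : ContDiffAt ℝ ∞ f x)
    (i : Fin N) : ContDiffAt ℝ ∞ (partialDeriv i f) x :=
  (hf.fderiv_right (m := ∞) (by simp)).clm_apply contDiffAt_const

lemma Filter.EventuallyEq.partialDeriv_eq {f g : RN N → ℝ} {x : RN N} (h : f =ᶠ[𝓝 x] g)
    (i : Fin N) : partialDeriv i f x = partialDeriv i g x := by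
  simp only [partialDeriv, h.fderiv_eq]

lemma partialDeriv_mul {f g : RN N → ℝ} {x : RN N} (hf : DifferentiableAt ℝ f x)
    (hg : DifferentiableAt ℝ g x) (i : Fin N) :
    partialDeriv i (fun y => f y * g y) x =
      f x * partialDeriv i g x + g x * partialDeriv i f x := by
  simp [partialDeriv, fderiv_fun_mul hf hg]

lemma partialDeriv_comm {f : RN N → ℝ} {x : RN N} (hf : ContDiffAt ℝ ∞ f x) (i j : Fin N) :
    partialDeriv i (partialDeriv j f) x = partialDeriv j (partialDeriv i f) x := by
  have hd : DifferentiableAt ℝ (fderiv ℝ f) x :=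
    (hf.fderiv_right (m := ∞) (by simp)).differentiableAt (by simp)
  have h : ∀ k l : Fin N, partialDeriv k (partialDeriv l f) x =
      fderiv ℝ (fderiv ℝ f) x (basisVec k) (basisVec l) := by
    intro k l
    rw [partialDeriv, show partialDeriv l f =
      fun x => (fderiv ℝ f x) ((fun _ => basisVec l) x) from rfl,
      fderiv_clm_apply hd (differentiableAt_const _)]
    simp
  rw [h, h]
  exact (hf.isSymmSndFDerivAt (by simpa using ENat.LEInfty.out)) _ _

lemma laplacian_eq_sum_partialDeriv {f : RN N → ℝ} {x : RN N} (hf : ContDiffAt ℝ ∞ f x) :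
    Laplacian.laplacian f x = ∑ i, partialDeriv i (partialDeriv i f) x := by
  have hd : DifferentiableAt ℝ (fderiv ℝ f) x :=
    (hf.fderiv_right (m := ∞) (by simp)).differentiableAt (by simp)
  rw [InnerProductSpace.laplacian_eq_iteratedFDeriv_orthonormalBasis f
    (EuclideanSpace.basisFun (Fin N) ℝ)]
  refine Finset.sum_congr rfl fun i _ => ?_
  rw [iteratedFDeriv_two_apply, partialDeriv, show partialDeriv i f =
      fun x => (fderiv ℝ f x) ((fun _ => basisVec i) x) from rfl,
      fderiv_clm_apply hd (differentiableAt_const _)]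
  simp

lemma contDiffAt_norm_rpow (s : ℝ) {x : RN N} (hx : x ≠ 0) :
    ContDiffAt ℝ ∞ (fun y : RN N => ‖y‖ ^ s) x :=
  (contDiffAt_norm ℝ hx).rpow_const_of_ne (norm_ne_zero_iff.2 hx)

lemma partialDeriv_norm_rpow (s : ℝ) {x : RN N} (hx : x ≠ 0) (i : Fin N) :
    partialDeriv i (fun y : RN N => ‖y‖ ^ s) x = s * ‖x‖ ^ (s - 2) * x i := by
  have hpos : 0 < ‖x‖ := norm_pos_iff.2 hx
  have h1 : HasFDerivAt (fun y : RN N => (‖y‖ ^ 2) ^ (s / 2))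
      ((s / 2 * (‖x‖ ^ 2) ^ (s / 2 - 1)) • (2 • (innerSL ℝ x))) x :=
    ((hasStrictFDerivAt_norm_sq x).hasFDerivAt).rpow_const (Or.inl (by positivity))
  have h2 : (fun y : RN N => (‖y‖ ^ 2) ^ (s / 2)) = fun y => ‖y‖ ^ s := by
    funext y
    rw [← Real.rpow_natCast, ← Real.rpow_mul (norm_nonneg _)]
    congr 1
    push_cast
    ring
  rw [h2] at h1
  have h3 : (‖x‖ ^ 2) ^ (s / 2 - 1) = ‖x‖ ^ (s - 2) := by
    rw [← Real.rpow_natCast, ← Real.rpow_mul (norm_nonneg _)]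
    congr 1
    push_cast
    ring
  rw [partialDeriv, h1.fderiv, h3]
  simp [basisVec, EuclideanSpace.inner_single_right]
  ring

/-- Extension by the value `0` at the origin. -/
def extendZero (f : {x : RN N // x ≠ 0} → ℝ) (x : RN N) : ℝ :=
  if h : x ≠ 0 then f ⟨x, h⟩ else 0

lemma extendZero_apply (f : {x : RN N // x ≠ 0} → ℝ) {x : RN N} (hx : x ≠ 0) :
    extendZero f x = f ⟨x, hx⟩ := dif_pos hx

@[simp] lemma extendZero_zero (f : {x : RN N // x ≠ 0} → ℝ) : extendZero f 0 = 0 := by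
  simp [extendZero]

lemma extendZero_mul (f g : {x : RN N // x ≠ 0} → ℝ) :
    extendZero (f * g) = fun x => extendZero f x * extendZero g x := by
  funext x
  by_cases hx : x = 0 <;> simp [extendZero, hx]

lemma extendZero_add (f g : {x : RN N // x ≠ 0} → ℝ) :
    extendZero (f + g) = fun x => extendZero f x + extendZero g x := by
  funext x
  by_cases hx : x = 0 <;> simp [extendZero, hx]

lemma extendZero_smul (c : ℝ) (f : {x : RN N // x ≠ 0} → ℝ) :
    extendZero (c • f) = fun x => c * extendZero f x := by
  funext x
  by_cases hx : x = 0 <;> simp [extendZero, hx]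

lemma extendZero_eventuallyEq (g : RN N → ℝ) {x : RN N} (hx : x ≠ 0) :
    extendZero (fun y : {x : RN N // x ≠ 0} => g y) =ᶠ[𝓝 x] g := by
  filter_upwards [isOpen_ne.mem_nhds hx] with y hy
  exact extendZero_apply _ hy

variable (N) in
/-- The algebra of smooth functions on `ℝ^N \ {0}`, as functions on the subtype, so that identities
which fail at the origin hold in the algebra. -/
def puncturedSmooth : Subalgebra ℝ ({x : RN N // x ≠ 0} → ℝ) where
  carrier := {f | ∀ x ≠ 0, ContDiffAt ℝ ∞ (extendZero f) x}
  mul_mem' hf hg x hx := by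
    rw [extendZero_mul]
    exact (hf x hx).mul (hg x hx)
  add_mem' hf hg x hx := by
    rw [extendZero_add]
    exact (hf x hx).add (hg x hx)
  algebraMap_mem' c x hx :=
    contDiffAt_const.congr_of_eventuallyEq (extendZero_eventuallyEq (fun _ => c) hx)

variable (N) in
/-- The type of smooth functions on `ℝ^N \ {0}`. -/
abbrev PuncturedSmooth : Type := puncturedSmooth N

namespace PuncturedSmooth

/-- A smooth function on `ℝ^N \ {0}` as a function on `ℝ^N`, with value `0` at the origin. -/
def ext (f : PuncturedSmooth N) : RN N → ℝ := extendZero f.1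

lemma contDiffAt_ext (f : PuncturedSmooth N) {x : RN N} (hx : x ≠ 0) :
    ContDiffAt ℝ ∞ f.ext x := f.2 x hx

lemma differentiableAt_ext (f : PuncturedSmooth N) {x : RN N} (hx : x ≠ 0) :
    DifferentiableAt ℝ f.ext x := (f.2 x hx).differentiableAt (by simp)

@[simp] lemma ext_mul (f g : PuncturedSmooth N) (x : RN N) : (f * g).ext x = f.ext x * g.ext x :=
  congrFun (extendZero_mul f.1 g.1) x

@[simp] lemma ext_add (f g : PuncturedSmooth N) (x : RN N) : (f + g).ext x = f.ext x + g.ext x :=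
  congrFun (extendZero_add f.1 g.1) x

@[simp] lemma ext_smul (c : ℝ) (f : PuncturedSmooth N) (x : RN N) :
    (c • f).ext x = c * f.ext x :=
  congrFun (extendZero_smul c f.1) x

/-- Evaluation at `x`, as a linear map. -/
def extHom (x : RN N) : PuncturedSmooth N →ₗ[ℝ] ℝ where
  toFun f := f.ext x
  map_add' f g := ext_add f g x
  map_smul' c f := ext_smul c f x

@[simp] lemma ext_sub (f g : PuncturedSmooth N) (x : RN N) : (f - g).ext x = f.ext x - g.ext x :=
  map_sub (extHom x) f g

@[simp] lemma ext_sum {ι : Type*} (s : Finset ι) (f : ι → PuncturedSmooth N) (x : RN N) :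
    (∑ i ∈ s, f i).ext x = ∑ i ∈ s, (f i).ext x :=
  map_sum (extHom x) f s

@[simp] lemma ext_zero (x : RN N) : (0 : PuncturedSmooth N).ext x = 0 := map_zero (extHom x)

lemma ext_one {x : RN N} (hx : x ≠ 0) : (1 : PuncturedSmooth N).ext x = 1 :=
  extendZero_apply _ hx

@[simp] lemma ext_apply_zero (f : PuncturedSmooth N) : f.ext 0 = 0 := extendZero_zero _

lemma ext_injective {f g : PuncturedSmooth N} (h : ∀ x ≠ 0, f.ext x = g.ext x) : f = g := by
  refine Subtype.ext (funext fun ⟨x, hx⟩ => ?_)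
  have := h x hx
  rwa [ext, ext, extendZero_apply _ hx, extendZero_apply _ hx] at this

/-- The restriction to `ℝ^N \ {0}` of a function that is smooth away from the origin. -/
def ofFun (g : RN N → ℝ) (hg : ∀ x ≠ 0, ContDiffAt ℝ ∞ g x) : PuncturedSmooth N :=
  ⟨fun y => g y, fun x hx => (hg x hx).congr_of_eventuallyEq (extendZero_eventuallyEq g hx)⟩

lemma ext_ofFun {g : RN N → ℝ} (hg : ∀ x ≠ 0, ContDiffAt ℝ ∞ g x) {x : RN N} (hx : x ≠ 0) :
    (ofFun g hg).ext x = g x := extendZero_apply _ hx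

lemma ext_ofFun_eventuallyEq {g : RN N → ℝ} (hg : ∀ x ≠ 0, ContDiffAt ℝ ∞ g x) {x : RN N}
    (hx : x ≠ 0) : (ofFun g hg).ext =ᶠ[𝓝 x] g := extendZero_eventuallyEq g hx

/-- The derivation `|x| ∂ᵢ`. -/
def scaledDeriv (i : Fin N) : Derivation ℝ (PuncturedSmooth N) (PuncturedSmooth N) :=
  Derivation.mk'
    { toFun := fun f => ofFun (fun x => ‖x‖ * partialDeriv i f.ext x) fun x hx =>
        (contDiffAt_norm ℝ hx).mul ((f.contDiffAt_ext hx).partialDeriv i)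
      map_add' := fun f g => ext_injective fun x hx => by
        have h : (f + g).ext = fun x => f.ext x + g.ext x := funext fun x => ext_add f g x
        rw [ext_add, ext_ofFun _ hx, ext_ofFun _ hx, ext_ofFun _ hx, h]
        simp only [partialDeriv]
        rw [fderiv_fun_add (f.differentiableAt_ext hx) (g.differentiableAt_ext hx)]
        simp [mul_add]
      map_smul' := fun c f => ext_injective fun x hx => by
        have h : (c • f).ext = fun x => c * f.ext x := funext fun x => ext_smul c f x
        rw [ext_smul, ext_ofFun _ hx, ext_ofFun _ hx, h]
        simp only [partialDeriv]
        rw [fderiv_const_mul (f.differentiableAt_ext hx)]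
        simp [mul_left_comm] }
    fun f g => ext_injective fun x hx => by
      have h : (f * g).ext = fun x => f.ext x * g.ext x := funext fun x => ext_mul f g x
      simp only [LinearMap.coe_mk, AddHom.coe_mk, smul_eq_mul, ext_add, ext_mul, ext_ofFun _ hx]
      rw [h, partialDeriv_mul (f.differentiableAt_ext hx) (g.differentiableAt_ext hx)]
      ring

lemma ext_scaledDeriv (i : Fin N) (f : PuncturedSmooth N) :
    (scaledDeriv i f).ext = fun x => ‖x‖ * partialDeriv i f.ext x := by
  funext x
  by_cases hx : x = 0
  · simp [hx]
  · exact ext_ofFun _ hx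

lemma ext_scaledDeriv_apply (i : Fin N) (f : PuncturedSmooth N) (x : RN N) :
    (scaledDeriv i f).ext x = ‖x‖ * partialDeriv i f.ext x := congrFun (ext_scaledDeriv i f) x

/-- The function `|x|^s`. -/
def normRpow (s : ℝ) : PuncturedSmooth N :=
  ofFun (fun x => ‖x‖ ^ s) fun _ hx => contDiffAt_norm_rpow s hx

/-- The function `xᵢ / |x|`. -/
def dir (i : Fin N) : PuncturedSmooth N :=
  ofFun (fun x => x i * ‖x‖ ^ (-1 : ℝ)) fun _ hx =>
    (contDiffAt_euclidean.1 contDiffAt_id i).mul (contDiffAt_norm_rpow _ hx)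

lemma ext_normRpow (s : ℝ) {x : RN N} (hx : x ≠ 0) : (normRpow s).ext x = ‖x‖ ^ s :=
  ext_ofFun _ hx

lemma ext_dir (i : Fin N) {x : RN N} (hx : x ≠ 0) : (dir i).ext x = x i * ‖x‖ ^ (-1 : ℝ) :=
  ext_ofFun _ hx

lemma partialDeriv_coord (i j : Fin N) (x : RN N) :
    partialDeriv i (fun y : RN N => y j) x = if i = j then 1 else 0 := by
  have : (fun y : RN N => y j) = (EuclideanSpace.proj j : RN N →L[ℝ] ℝ) := rfl
  rw [partialDeriv, this, ContinuousLinearMap.fderiv]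
  simp [basisVec, eq_comm]

lemma sum_dir_mul_dir : ∑ i, (dir i : PuncturedSmooth N) * dir i = 1 := by
  refine ext_injective fun x hx => ?_
  have hpos : 0 < ‖x‖ := norm_pos_iff.2 hx
  simp only [ext_sum, ext_mul, ext_dir _ hx, ext_one hx]
  have h : ∀ i, x i * ‖x‖ ^ (-1 : ℝ) * (x i * ‖x‖ ^ (-1 : ℝ)) = x i ^ 2 * (‖x‖ ^ 2)⁻¹ := by
    intro i
    rw [Real.rpow_neg_one]
    field_simp
  simp only [h, ← Finset.sum_mul, ← EuclideanSpace.real_norm_sq_eq]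
  field_simp

lemma scaledDeriv_dir (i j : Fin N) :
    scaledDeriv i (dir j : PuncturedSmooth N) = (if i = j then 1 else 0) - dir i * dir j := by
  refine ext_injective fun x hx => ?_
  have hpos : 0 < ‖x‖ := norm_pos_iff.2 hx
  rw [ext_scaledDeriv, ext_sub, ext_mul, ext_dir _ hx, ext_dir _ hx]
  have h0 : ∀ p : Prop, [Decidable p] →
      (if p then 1 else 0 : PuncturedSmooth N).ext x = if p then 1 else 0 := by
    intro p _
    split_ifs
    · exact ext_one hx
    · exact ext_zero x
  rw [h0]
  simp only [dir, (ext_ofFun_eventuallyEq _ hx).partialDeriv_eq]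
  rw [partialDeriv_mul (by fun_prop) ((contDiffAt_norm_rpow _ hx).differentiableAt (by simp)),
    partialDeriv_norm_rpow _ hx, partialDeriv_coord]
  have e1 : ‖x‖ ^ (-1 - 2 : ℝ) = (‖x‖ ^ 3)⁻¹ := by
    rw [← Real.rpow_natCast, ← Real.rpow_neg hpos.le]; norm_num
  rw [e1, Real.rpow_neg_one]
  split_ifs <;> field_simp <;> ring

lemma scaledDeriv_normRpow (i : Fin N) (s : ℝ) :
    scaledDeriv i (normRpow s : PuncturedSmooth N) = s • (dir i * normRpow s) := by
  refine ext_injective fun x hx => ?_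
  have hpos : 0 < ‖x‖ := norm_pos_iff.2 hx
  rw [ext_scaledDeriv, ext_smul, ext_mul, ext_dir _ hx, ext_normRpow _ hx]
  simp only [normRpow, (ext_ofFun_eventuallyEq _ hx).partialDeriv_eq]
  rw [partialDeriv_norm_rpow _ hx, Real.rpow_neg_one, Real.rpow_sub hpos]
  simp only [Real.rpow_ofNat]
  field_simp

lemma partialDeriv_ext_scaledDeriv (i j : Fin N) (f : PuncturedSmooth N) {x : RN N} (hx : x ≠ 0) :
    ‖x‖ * partialDeriv i (scaledDeriv j f).ext x =
      ‖x‖ ^ 2 * partialDeriv i (partialDeriv j f.ext) x + x i * partialDeriv j f.ext x := by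
  have hpos : 0 < ‖x‖ := norm_pos_iff.2 hx
  have h := partialDeriv_norm_rpow 1 hx i
  simp only [Real.rpow_one] at h
  rw [ext_scaledDeriv, partialDeriv_mul ((contDiffAt_norm (n := ∞) ℝ hx).differentiableAt (by simp))
    (((f.contDiffAt_ext hx).partialDeriv j).differentiableAt (by simp)), h]
  have e1 : ‖x‖ ^ (1 - 2 : ℝ) = ‖x‖⁻¹ := by
    rw [← Real.rpow_neg_one]; norm_num
  rw [e1]
  field_simp

lemma scaledDeriv_comm (i j : Fin N) (f : PuncturedSmooth N) :
    scaledDeriv i (scaledDeriv j f) - scaledDeriv j (scaledDeriv i f) =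
      dir i * scaledDeriv j f - dir j * scaledDeriv i f := by
  refine ext_injective fun x hx => ?_
  have hpos : 0 < ‖x‖ := norm_pos_iff.2 hx
  simp only [ext_sub, ext_mul, ext_dir _ hx]
  rw [ext_scaledDeriv_apply i (scaledDeriv j f), ext_scaledDeriv_apply j (scaledDeriv i f),
    partialDeriv_ext_scaledDeriv _ _ _ hx,
    partialDeriv_ext_scaledDeriv _ _ _ hx, partialDeriv_comm (f.contDiffAt_ext hx),
    ext_scaledDeriv_apply, ext_scaledDeriv_apply, Real.rpow_neg_one]
  field_simp
  ring

variable (N) in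
/-- The ideal of functions with support in an annulus `δ ≤ |x| ≤ R`. -/
def annular : Ideal (PuncturedSmooth N) where
  carrier := {f | ∃ δ > 0, ∃ R, ∀ x, f.ext x ≠ 0 → δ ≤ ‖x‖ ∧ ‖x‖ ≤ R}
  add_mem' := by
    rintro f g ⟨δ, hδ, R, hf⟩ ⟨δ', hδ', R', hg⟩
    refine ⟨min δ δ', lt_min hδ hδ', max R R', fun x hx => ?_⟩
    by_cases h : f.ext x = 0
    · have := hg x fun h' => hx (by rw [ext_add, h, h', add_zero])
      exact ⟨(min_le_right _ _).trans this.1, this.2.trans (le_max_right _ _)⟩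
    · exact ⟨(min_le_left _ _).trans (hf x h).1, (hf x h).2.trans (le_max_left _ _)⟩
  zero_mem' := ⟨1, one_pos, 0, fun x hx => absurd (ext_zero x) hx⟩
  smul_mem' := by
    rintro g f ⟨δ, hδ, R, hf⟩
    refine ⟨δ, hδ, R, fun x hx => hf x fun h => hx ?_⟩
    rw [smul_eq_mul, ext_mul, h, mul_zero]

lemma scaledDeriv_mem_annular (i : Fin N) {f : PuncturedSmooth N} (hf : f ∈ annular N) :
    scaledDeriv i f ∈ annular N := by
  obtain ⟨δ, hδ, R, h⟩ := hf
  refine ⟨δ, hδ, R, fun x hx => ?_⟩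
  by_contra hx'
  have hopen : IsOpen {y : RN N | ¬ (δ ≤ ‖y‖ ∧ ‖y‖ ≤ R)} := by
    have : IsClosed {y : RN N | δ ≤ ‖y‖ ∧ ‖y‖ ≤ R} :=
      (isClosed_le continuous_const continuous_norm).inter
        (isClosed_le continuous_norm continuous_const)
    exact this.isOpen_compl
  have h0 : f.ext =ᶠ[𝓝 x] fun _ => 0 := by
    filter_upwards [hopen.mem_nhds hx'] with y hy
    by_contra hne
    exact hy (h y hne)
  refine hx ?_
  rw [ext_scaledDeriv_apply, h0.partialDeriv_eq]
  simp [partialDeriv]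

lemma isTestFun_ext {f : PuncturedSmooth N} (hf : f ∈ annular N) : IsTestFun f.ext := by
  obtain ⟨δ, hδ, R, h⟩ := hf
  constructor
  · refine contDiff_iff_contDiffAt.2 fun x => ?_
    by_cases hx : x = 0
    · have h0 : f.ext =ᶠ[𝓝 x] fun _ => 0 := by
        filter_upwards [Metric.ball_mem_nhds x hδ] with y hy
        by_contra hne
        rw [hx, mem_ball_zero_iff] at hy
        linarith [(h y hne).1]
      exact contDiffAt_const.congr_of_eventuallyEq h0
    · exact f.contDiffAt_ext hx
  · refine HasCompactSupport.intro (isCompact_closedBall (0 : RN N) R) fun x hx => ?_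
    by_contra hne
    exact hx (mem_closedBall_zero_iff.2 (h x hne).2)

end PuncturedSmooth

lemma IsTestFun.integrable {φ : RN N → ℝ} (hφ : IsTestFun φ) : Integrable φ :=
  hφ.1.continuous.integrable_of_hasCompactSupport hφ.2

protected lemma IsTestFun.partialDeriv {φ : RN N → ℝ} (hφ : IsTestFun φ) (i : Fin N) :
    IsTestFun (partialDeriv i φ) :=
  ⟨contDiff_iff_contDiffAt.2 fun _ => hφ.1.contDiffAt.partialDeriv i,
    hφ.2.fderiv_apply ℝ _⟩

lemma IsTestFun.integral_partialDeriv {φ : RN N → ℝ} (hφ : IsTestFun φ) (i : Fin N) :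
    ∫ x, partialDeriv i φ x = 0 := by
  have h := integral_mul_fderiv_eq_neg_fderiv_mul_of_integrable (μ := volume)
    (f := fun _ => (1 : ℝ)) (g := φ) (v := basisVec i) (by simp)
    ((hφ.partialDeriv i).integrable.congr (by simp; rfl))
    (by simpa using hφ.integrable) (by simp)
    (fun x _ => (hφ.1.contDiffAt).differentiableAt (by simp))
  simp only [one_mul, fderiv_const_apply, zero_apply, zero_mul, integral_zero, neg_zero] at h
  exact h

namespace PuncturedSmooth

lemma ext_mul_normRpow (f : PuncturedSmooth N) (s : ℝ) (x : RN N) :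
    (f * normRpow s).ext x = f.ext x * ‖x‖ ^ s := by
  by_cases hx : x = 0
  · simp [hx]
  · rw [ext_mul, ext_normRpow s hx]

lemma integrable_mul_norm_rpow {f : PuncturedSmooth N} (hf : f ∈ annular N) (s : ℝ) :
    Integrable fun x => f.ext x * ‖x‖ ^ s := by
  have := (isTestFun_ext ((annular N).mul_mem_right (normRpow s) hf)).integrable
  simpa only [funext (ext_mul_normRpow f s)] using this

variable (N) in
lemma exists_invariantIntegral : ∃ I : PuncturedSmooth N →ₗ[ℝ] ℝ,
    ∀ f ∈ annular N, I f = ∫ x, f.ext x * ‖x‖ ^ (-N : ℝ) := by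
  let I₀ : (annular N).restrictScalars ℝ →ₗ[ℝ] ℝ :=
    { toFun := fun f => ∫ x, f.1.ext x * ‖x‖ ^ (-N : ℝ)
      map_add' := fun f g => by
        rw [← integral_add (integrable_mul_norm_rpow f.2 _) (integrable_mul_norm_rpow g.2 _)]
        simp [add_mul]
      map_smul' := fun c f => by
        rw [RingHom.id_apply, smul_eq_mul, ← integral_const_mul]
        simp [mul_assoc] }
  obtain ⟨I, hI⟩ := I₀.exists_extend
  exact ⟨I, fun f hf => congrArg (fun L => L ⟨f, hf⟩) hI⟩

variable (N) in
/-- A linear functional that is integration against `|x|^{-N} dx` on `annular N`; its values on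
other functions are those of an arbitrary linear extension. -/
def invariantIntegral : PuncturedSmooth N →ₗ[ℝ] ℝ := (exists_invariantIntegral N).choose

lemma invariantIntegral_eq {f : PuncturedSmooth N} (hf : f ∈ annular N) :
    invariantIntegral N f = ∫ x, f.ext x * ‖x‖ ^ (-N : ℝ) :=
  (exists_invariantIntegral N).choose_spec f hf

lemma invariantIntegral_scaledDeriv (i : Fin N) {f : PuncturedSmooth N} (hf : f ∈ annular N) :
    invariantIntegral N (scaledDeriv i f) = ((N : ℝ) - 1) * invariantIntegral N (dir i * f) := by
  have hfd := (annular N).mul_mem_left (dir i) hf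
  have hg := (annular N).mul_mem_right (normRpow (1 - N : ℝ)) hf
  rw [invariantIntegral_eq (scaledDeriv_mem_annular i hf), invariantIntegral_eq hfd,
    ← integral_const_mul, ← sub_eq_zero,
    ← integral_sub (integrable_mul_norm_rpow (scaledDeriv_mem_annular i hf) _)
      ((integrable_mul_norm_rpow hfd _).const_mul _),
    ← (isTestFun_ext hg).integral_partialDeriv i]
  refine integral_congr_ae ?_
  have : Nontrivial (RN N) := ⟨⟨basisVec i, 0, by simp [basisVec]⟩⟩
  filter_upwards [compl_mem_ae_iff.2 (measure_singleton (μ := volume) (0 : RN N))] with x hx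
  have hx : x ≠ 0 := hx
  have hpos : 0 < ‖x‖ := norm_pos_iff.2 hx
  rw [funext (ext_mul_normRpow f _), partialDeriv_mul (f.differentiableAt_ext hx)
    ((contDiffAt_norm_rpow _ hx).differentiableAt (by simp)), partialDeriv_norm_rpow _ hx,
    ext_mul, ext_dir _ hx, ext_scaledDeriv, Real.rpow_sub hpos, Real.rpow_sub hpos,
    Real.rpow_neg hpos.le]
  simp only [Real.rpow_one, Real.rpow_ofNat, Real.rpow_neg_one]
  field_simp
  ring

variable (N) in
/-- The smooth functions on `ℝ^N \ {0}` obey the rules of polar calculus. -/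
def polarCalculus : PolarCalculus (PuncturedSmooth N) N where
  F := scaledDeriv
  dir := dir
  S := annular N
  I := invariantIntegral N
  sum_dir_mul_dir := sum_dir_mul_dir
  F_dir := scaledDeriv_dir
  F_comm := scaledDeriv_comm
  F_mem i _ hf := scaledDeriv_mem_annular i hf
  I_F i _ hf := invariantIntegral_scaledDeriv i hf
  I_mul_self_nonneg f hf := by
    rw [invariantIntegral_eq ((annular N).mul_mem_right f hf)]
    refine integral_nonneg fun x => ?_
    rw [ext_mul]
    exact mul_nonneg (mul_self_nonneg _) (by positivity)

end PuncturedSmooth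

/-! ### The three energies in polar form -/

lemma gradient_apply (f : RN N → ℝ) (x : RN N) (i : Fin N) :
    gradient f x i = partialDeriv i f x := by
  have h : inner ℝ (gradient f x) (basisVec i) = fderiv ℝ f x (basisVec i) := by
    rw [gradient, InnerProductSpace.toDual_symm_apply]
  rw [partialDeriv, ← h, EuclideanSpace.inner_single_right]
  simp

lemma norm_gradient_sq (f : RN N → ℝ) (x : RN N) :
    ‖gradient f x‖ ^ 2 = ∑ i, partialDeriv i f x ^ 2 := by
  rw [EuclideanSpace.real_norm_sq_eq]
  simp only [gradient_apply]

namespace PuncturedSmooth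

/-- `|x|² Δ` in terms of the derivations `|x| ∂ᵢ`. -/
lemma ext_laplacian (f : PuncturedSmooth N) {x : RN N} (hx : x ≠ 0) :
    (∑ i, scaledDeriv i (scaledDeriv i f) - (polarCalculus N).E f).ext x =
      ‖x‖ ^ 2 * Laplacian.laplacian f.ext x := by
  have hpos : 0 < ‖x‖ := norm_pos_iff.2 hx
  rw [PolarCalculus.E_apply]
  change (∑ i, scaledDeriv i (scaledDeriv i f) - ∑ i, dir i * scaledDeriv i f).ext x = _
  rw [ext_sub, ext_sum, ext_sum, laplacian_eq_sum_partialDeriv (f.contDiffAt_ext hx),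
    Finset.mul_sum, ← Finset.sum_sub_distrib]
  refine Finset.sum_congr rfl fun i _ => ?_
  rw [ext_scaledDeriv_apply i (scaledDeriv i f), partialDeriv_ext_scaledDeriv _ _ _ hx, ext_mul,
    ext_dir _ hx, ext_scaledDeriv_apply, Real.rpow_neg_one]
  field_simp
  ring

lemma ext_sum_scaledDeriv_sq (f : PuncturedSmooth N) (x : RN N) :
    (∑ i, scaledDeriv i f * scaledDeriv i f).ext x = ‖x‖ ^ 2 * ‖gradient f.ext x‖ ^ 2 := by
  rw [norm_gradient_sq, ext_sum, Finset.mul_sum]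
  refine Finset.sum_congr rfl fun i _ => ?_
  rw [ext_mul, ext_scaledDeriv_apply]
  ring

lemma normRpow_mul_normRpow (s t : ℝ) :
    (normRpow s * normRpow t : PuncturedSmooth N) = normRpow (s + t) := by
  refine ext_injective fun x hx => ?_
  rw [ext_mul, ext_normRpow _ hx, ext_normRpow _ hx, ext_normRpow _ hx,
    Real.rpow_add (norm_pos_iff.2 hx)]

lemma normRpow_zero : (normRpow 0 : PuncturedSmooth N) = 1 := by
  refine ext_injective fun x hx => ?_
  rw [ext_normRpow _ hx, ext_one hx, Real.rpow_zero]

lemma ae_ne_zero (hN : N ≠ 0) : ∀ᵐ x : RN N, x ≠ 0 := by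
  have : Nontrivial (RN N) := ⟨⟨basisVec ⟨0, Nat.pos_of_ne_zero hN⟩, 0, by simp [basisVec]⟩⟩
  exact compl_mem_ae_iff.2 (measure_singleton (μ := volume) (0 : RN N))

lemma integral_eq_invariantIntegral (hN : N ≠ 0) {g : RN N → ℝ} {f : PuncturedSmooth N}
    (hf : f ∈ annular N) (h : ∀ x ≠ 0, g x = f.ext x * ‖x‖ ^ (-N : ℝ)) :
    ∫ x, g x = (polarCalculus N).I f := by
  change _ = invariantIntegral N f
  rw [invariantIntegral_eq hf]
  refine integral_congr_ae ?_
  filter_upwards [ae_ne_zero hN] with x hx using h x hx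

lemma polarCalculus_F_normRpow (s : ℝ) (i : Fin N) :
    (polarCalculus N).F i (normRpow s) = s • ((polarCalculus N).dir i * normRpow s) :=
  scaledDeriv_normRpow i s

variable {γ a : ℝ} {v : PuncturedSmooth N}

lemma hardyEnergy_eq (hN : N ≠ 0) (ha : 2 * a = N - 4 - γ) (hv : v ∈ annular N) :
    hardyEnergy γ (normRpow (-a) * v).ext = (polarCalculus N).I (v * v) := by
  refine integral_eq_invariantIntegral hN ((annular N).mul_mem_left v hv) fun x hx => ?_
  have hpos : 0 < ‖x‖ := norm_pos_iff.2 hx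
  rw [ext_mul, ext_mul, ext_normRpow _ hx, mul_pow, sq (‖x‖ ^ (-a)),
    ← mul_assoc, ← Real.rpow_add hpos, ← Real.rpow_add hpos,
    show -γ - 4 + (-a + -a) = -N by linarith]
  ring

lemma gradientEnergy_eq (hN : N ≠ 0) (ha : 2 * a = N - 4 - γ) (hv : v ∈ annular N) :
    gradientEnergy γ (gradient (normRpow (-a) * v).ext) =
      (polarCalculus N).I ((polarCalculus N).E v * (polarCalculus N).E v)
      + a ^ 2 * (polarCalculus N).I (v * v)
      + ∑ i, (polarCalculus N).I ((polarCalculus N).D i v * (polarCalculus N).D i v) := by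
  set P := polarCalculus N
  have hv' : v ∈ P.S := hv
  have hmem : (P.E v + (-a) • v) * (P.E v + (-a) • v) + ∑ i, P.D i v * P.D i v ∈ P.S := by
    refine P.S.add_mem (P.S.mul_mem_left _ (P.S.add_mem (P.E_mem hv) ?_))
      (P.S.sum_mem fun i _ => P.S.mul_mem_left _ (P.D_mem i hv))
    rw [Algebra.smul_def]
    exact P.S.mul_mem_left _ hv
  have h := integral_eq_invariantIntegral (g := fun x =>
    ‖x‖ ^ (-γ - 2) * ‖gradient (normRpow (-a) * v).ext x‖ ^ 2) hN hmem fun x hx => by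
    have hpos : 0 < ‖x‖ := norm_pos_iff.2 hx
    have h1 := ext_sum_scaledDeriv_sq (normRpow (-a) * v) x
    have h2 := P.sum_F_homogeneous_mul (polarCalculus_F_normRpow (-a)) v
    rw [show (∑ i, scaledDeriv i (normRpow (-a) * v) * scaledDeriv i (normRpow (-a) * v)) = _
      from h2,
      normRpow_mul_normRpow, ext_mul, ext_normRpow _ hx] at h1
    have h3 : ‖x‖ ^ (-γ - 2) = ‖x‖ ^ (-N : ℝ) * ‖x‖ ^ (2 * a) * ‖x‖ ^ 2 := by
      rw [← Real.rpow_natCast, ← Real.rpow_add hpos, ← Real.rpow_add hpos]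
      congr 1
      push_cast
      linarith
    have h4 : ‖x‖ ^ (2 * a) * ‖x‖ ^ (-a + -a) = 1 := by
      rw [← Real.rpow_add hpos, show 2 * a + (-a + -a) = 0 by ring, Real.rpow_zero]
    rw [h3, mul_assoc, ← h1]
    linear_combination (‖x‖ ^ (-N : ℝ) *
      ((P.E v + (-a) • v) * (P.E v + (-a) • v) + ∑ i, P.D i v * P.D i v).ext x) * h4
  rw [gradientEnergy, h]
  have h0 : P.I (v * P.E v) = 0 := by
    have := P.I_mul_E (g := v) hv'
    rw [mul_comm (P.E v)] at this
    linarith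
  have h5 : (P.E v + (-a) • v) * (P.E v + (-a) • v) + ∑ i, P.D i v * P.D i v =
      P.E v * P.E v + a ^ 2 • (v * v) - (2 * a) • (v * P.E v) + ∑ i, P.D i v * P.D i v := by
    simp only [Algebra.smul_def, map_mul, map_pow, map_ofNat, map_neg]
    ring
  change P.I _ = _
  rw [h5]
  simp only [map_add, map_sub, map_smul, smul_eq_mul, h0, map_sum]
  ring

lemma rellichEnergy_eq (hN : N ≠ 0) (ha : 2 * a = N - 4 - γ) (hv : v ∈ annular N) :
    rellichEnergy γ (Laplacian.laplacian (normRpow (-a) * v).ext) =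
      (polarCalculus N).I ((polarCalculus N).E ((polarCalculus N).E v)
        * (polarCalculus N).E ((polarCalculus N).E v))
      + ((2 + γ) ^ 2 + 2 * (a * (N - 2 - a))) *
        (polarCalculus N).I ((polarCalculus N).E v * (polarCalculus N).E v)
      + (a * (N - 2 - a)) ^ 2 * (polarCalculus N).I (v * v)
      + (polarCalculus N).I ((polarCalculus N).Λ v * (polarCalculus N).Λ v)
      + 2 * ∑ i, (polarCalculus N).I ((polarCalculus N).D i ((polarCalculus N).E v)
        * (polarCalculus N).D i ((polarCalculus N).E v))
      + 2 * (a * (N - 2 - a)) *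
        ∑ i, (polarCalculus N).I ((polarCalculus N).D i v * (polarCalculus N).D i v) := by
  set P := polarCalculus N
  have hv' : v ∈ P.S := hv
  set q := P.E (P.E v) + (2 + γ) • P.E v - (a * (N - 2 - a)) • v + P.Λ v with hq
  have hmem : q * q ∈ P.S := by
    refine P.S.mul_mem_left _ (P.S.add_mem (P.S.sub_mem (P.S.add_mem (P.E_mem (P.E_mem hv)) ?_) ?_)
      (P.Λ_mem hv))
    · rw [Algebra.smul_def]
      exact P.S.mul_mem_left _ (P.E_mem hv)
    · rw [Algebra.smul_def]
      exact P.S.mul_mem_left _ hv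
  have h := integral_eq_invariantIntegral (g := fun x =>
    ‖x‖ ^ (-γ) * ((Laplacian.laplacian (normRpow (-a) * v).ext : RN N → ℝ) x) ^ 2) hN hmem
    fun x hx => by
    have hpos : 0 < ‖x‖ := norm_pos_iff.2 hx
    have h1 := ext_laplacian (normRpow (-a) * v) hx
    have h2 := P.laplacian_homogeneous_mul (polarCalculus_F_normRpow (-a)) v
    rw [show (∑ i, scaledDeriv i (scaledDeriv i (normRpow (-a) * v)) - P.E (normRpow (-a) * v)) = _
      from h2, show (N : ℝ) - 2 + 2 * -a = 2 + γ by linarith,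
      show - -a * ((N : ℝ) - 2 + -a) = a * (N - 2 - a) by ring, ← hq, ext_mul,
      ext_normRpow _ hx] at h1
    have h3 : ‖x‖ ^ (-γ) = ‖x‖ ^ (-N : ℝ) * ‖x‖ ^ (2 * a) * (‖x‖ ^ 2) ^ 2 := by
      rw [← pow_mul, ← Real.rpow_natCast, ← Real.rpow_add hpos, ← Real.rpow_add hpos]
      congr 1
      push_cast
      linarith
    have h4 : ‖x‖ ^ (2 * a) * (‖x‖ ^ (-a)) ^ 2 = 1 := by
      rw [sq, ← Real.rpow_add hpos, ← Real.rpow_add hpos,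
        show 2 * a + (-a + -a) = 0 by ring, Real.rpow_zero]
    rw [h3, mul_assoc, ← mul_pow, ← h1, ext_mul]
    rw [mul_pow]
    linear_combination (‖x‖ ^ (-N : ℝ) * (q.ext x * q.ext x)) * h4
  rw [rellichEnergy, h, hq, P.I_rellich_sq _ _ hv']

end PuncturedSmooth

/-! ### The inequality for test functions supported away from the origin -/

/-- Test functions whose support does not contain the origin. -/
def IsPuncturedTestFun (φ : RN N → ℝ) : Prop := IsTestFun φ ∧ 0 ∉ tsupport φ

/-- `∫ |x|^{-γ-4} |u|² w dx` with the bounded positive weight `w = |x|² / (1 + |x|²)²`. -/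
def localisedHardyEnergy (γ : ℝ) (u : RN N → ℝ) : ℝ :=
  ∫ x, ‖x‖ ^ (-γ - 4) * (u x) ^ 2 * (‖x‖ ^ 2 / (1 + ‖x‖ ^ 2) ^ 2)

namespace PuncturedSmooth

lemma isPuncturedTestFun_ext {f : PuncturedSmooth N} (hf : f ∈ annular N) :
    IsPuncturedTestFun f.ext := by
  refine ⟨isTestFun_ext hf, ?_⟩
  obtain ⟨δ, hδ, R, h⟩ := hf
  rw [notMem_tsupport_iff_eventuallyEq]
  filter_upwards [Metric.ball_mem_nhds (0 : RN N) hδ] with y hy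
  by_contra hne
  rw [mem_ball_zero_iff] at hy
  linarith [(h y hne).1]

/-- The function `|x|² / (1 + |x|²)`. It is bounded by `1`, and its Euler derivative is positive. -/
def saturation : PuncturedSmooth N :=
  ofFun (fun x => ‖x‖ ^ 2 / (1 + ‖x‖ ^ 2)) fun x _ =>
    ((contDiff_norm_sq ℝ).contDiffAt).div
      (contDiffAt_const.add (contDiff_norm_sq ℝ).contDiffAt) (by positivity)

lemma ext_saturation {x : RN N} (hx : x ≠ 0) :
    (saturation : PuncturedSmooth N).ext x = ‖x‖ ^ 2 / (1 + ‖x‖ ^ 2) := ext_ofFun _ hx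

lemma ext_E_saturation {x : RN N} (hx : x ≠ 0) :
    ((polarCalculus N).E saturation).ext x = 2 * (‖x‖ ^ 2 / (1 + ‖x‖ ^ 2) ^ 2) := by
  set P := polarCalculus N
  have hE : P.E (normRpow 2) = (2 : ℝ) • normRpow 2 :=
    P.E_eq_of_radial fun i => by
      rw [polarCalculus_F_normRpow, mul_smul_comm]
  have h : (saturation : PuncturedSmooth N) * (1 + normRpow 2) = normRpow 2 := by
    refine ext_injective fun y hy => ?_
    rw [ext_mul, ext_add, ext_one hy, ext_saturation hy, ext_normRpow _ hy, Real.rpow_ofNat]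
    field_simp
  have h' := congrArg (fun f => (P.E f).ext x) h
  simp only [Derivation.leibniz, map_add, Derivation.map_one_eq_zero, hE, smul_eq_mul, ext_add,
    ext_mul, ext_smul, ext_one hx, ext_zero, ext_normRpow _ hx, ext_saturation hx,
    Real.rpow_ofNat] at h'
  field_simp at h' ⊢
  linear_combination h'

variable {γ a : ℝ} {v : PuncturedSmooth N}

lemma localisedHardyEnergy_eq (hN : N ≠ 0) (ha : 2 * a = N - 4 - γ) (hv : v ∈ annular N) :
    2 * localisedHardyEnergy γ (normRpow (-a) * v).ext =
      (polarCalculus N).I ((polarCalculus N).E saturation * (v * v)) := by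
  rw [localisedHardyEnergy, ← integral_const_mul]
  refine integral_eq_invariantIntegral hN
    ((annular N).mul_mem_left _ ((annular N).mul_mem_left v hv)) fun x hx => ?_
  have hpos : 0 < ‖x‖ := norm_pos_iff.2 hx
  rw [ext_mul, ext_mul, ext_mul, ext_E_saturation hx, ext_normRpow _ hx, mul_pow,
    sq (‖x‖ ^ (-a)), show (-N : ℝ) = -γ - 4 + (-a + -a) by linarith, Real.rpow_add hpos,
    Real.rpow_add hpos]
  ring

lemma invariantIntegral_saturation_le (hv : v ∈ annular N) :
    (polarCalculus N).I (saturation * v * (saturation * v)) ≤ (polarCalculus N).I (v * v) := by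
  change invariantIntegral N _ ≤ invariantIntegral N _
  have h1 := (annular N).mul_mem_left v hv
  have h2 := (annular N).mul_mem_left (saturation * v) ((annular N).mul_mem_left saturation hv)
  rw [invariantIntegral_eq h1, invariantIntegral_eq h2]
  refine integral_mono (integrable_mul_norm_rpow h2 _) (integrable_mul_norm_rpow h1 _) fun x => ?_
  by_cases hx : x = 0
  · simp [hx]
  have h3 : ‖x‖ ^ 2 / (1 + ‖x‖ ^ 2) ≤ 1 := by
    rw [div_le_one (by positivity)]
    linarith
  have h4 : (‖x‖ ^ 2 / (1 + ‖x‖ ^ 2)) ^ 2 ≤ 1 := pow_le_one₀ (by positivity) h3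
  simp only [ext_mul, ext_saturation hx]
  refine mul_le_mul_of_nonneg_right ?_ (by positivity)
  calc _ = (‖x‖ ^ 2 / (1 + ‖x‖ ^ 2)) ^ 2 * (v.ext x * v.ext x) := by ring
    _ ≤ 1 * (v.ext x * v.ext x) := mul_le_mul_of_nonneg_right h4 (mul_self_nonneg _)
    _ = _ := one_mul _

/-- The deficit in the Hardy-Rellich inequality, for `|x|^{-a} v`. The terms `‖E v‖²` and `‖v‖²`
cancel: with `b = N - 2 - a` one has `b - a = 2 + γ`, and the constant in the inequality is
`a² + b²`. -/
lemma hardyRellich_identity (hN : N ≠ 0) (ha : 2 * a = N - 4 - γ) (hv : v ∈ annular N) :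
    hardyRellichSum γ (normRpow (-a) * v).ext (Laplacian.laplacian (normRpow (-a) * v).ext)
      - hardyRellichConst N γ * gradientEnergy γ (gradient (normRpow (-a) * v).ext) =
      (polarCalculus N).I ((polarCalculus N).E ((polarCalculus N).E v)
        * (polarCalculus N).E ((polarCalculus N).E v))
      + 2 * ∑ i, (polarCalculus N).I ((polarCalculus N).D i ((polarCalculus N).E v)
        * (polarCalculus N).D i ((polarCalculus N).E v))
      + ((polarCalculus N).I ((polarCalculus N).Λ v * (polarCalculus N).Λ v)
      - (2 + γ) ^ 2 *
        ∑ i, (polarCalculus N).I ((polarCalculus N).D i v * (polarCalculus N).D i v)) := by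
  obtain rfl : γ = N - 4 - 2 * a := by linarith
  rw [hardyRellichSum, rellichEnergy_eq hN ha hv, gradientEnergy_eq hN ha hv,
    hardyEnergy_eq hN ha hv, hardyRellichConst]
  ring

lemma exists_eq_normRpow_mul {φ : RN N → ℝ} (hφ : IsPuncturedTestFun φ) (a : ℝ) :
    ∃ v ∈ annular N, φ = (normRpow (-a) * v).ext := by
  obtain ⟨⟨hs, hc⟩, h0⟩ := hφ
  set Φ : PuncturedSmooth N := ofFun φ fun x _ => hs.contDiffAt with hΦ
  have hΦe : ∀ x, Φ.ext x = φ x := by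
    intro x
    by_cases hx : x = 0
    · rw [hx, ext_apply_zero, image_eq_zero_of_notMem_tsupport h0]
    · exact ext_ofFun _ hx
  have hmem : Φ ∈ annular N := by
    obtain ⟨R, hR⟩ := hc.isCompact.isBounded.exists_norm_le
    obtain ⟨δ, hδ, hδ'⟩ := Metric.isOpen_iff.1 (isClosed_tsupport φ).isOpen_compl 0 h0
    refine ⟨δ, hδ, R, fun x hx => ?_⟩
    rw [hΦe] at hx
    have hx' : x ∈ tsupport φ := subset_tsupport _ hx
    refine ⟨?_, hR x hx'⟩
    by_contra hlt
    exact hδ' (mem_ball_zero_iff.2 (not_le.1 hlt)) hx'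
  refine ⟨normRpow a * Φ, (annular N).mul_mem_left _ hmem, funext fun x => ?_⟩
  rw [← mul_assoc, normRpow_mul_normRpow, neg_add_cancel, normRpow_zero, one_mul, hΦe]

end PuncturedSmooth

section TestFunctions

open PuncturedSmooth

variable {γ : ℝ} {φ : RN N → ℝ}

/-- A Hardy inequality for the gradient. -/
lemma IsPuncturedTestFun.hardy_le (hN : N ≠ 0) (hφ : IsPuncturedTestFun φ) :
    ((N - 4 - γ) / 2) ^ 2 * hardyEnergy γ φ ≤ gradientEnergy γ (gradient φ) := by
  obtain ⟨v, hv, rfl⟩ := exists_eq_normRpow_mul hφ ((N - 4 - γ) / 2)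
  rw [hardyEnergy_eq hN (by ring) hv, gradientEnergy_eq hN (by ring) hv]
  set P := polarCalculus N
  have hv' : v ∈ P.S := hv
  have h1 := P.I_mul_self_nonneg _ (P.E_mem hv')
  have h2 : 0 ≤ ∑ i, P.I (P.D i v * P.D i v) :=
    Finset.sum_nonneg fun i _ => P.I_mul_self_nonneg _ (P.D_mem i hv')
  linarith

/-- A Rellich inequality, with a constant that is far from optimal. -/
lemma IsPuncturedTestFun.rellich_le (hN : 5 ≤ N) (hγ : -2 < γ) (hγ' : γ ≤ 0)
    (hφ : IsPuncturedTestFun φ) :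
    (1 / 4) * gradientEnergy γ (gradient φ) ≤ rellichEnergy γ (Laplacian.laplacian φ) := by
  have hN0 : N ≠ 0 := by omega
  have hN' : (5 : ℝ) ≤ N := by exact_mod_cast hN
  obtain ⟨v, hv, rfl⟩ := exists_eq_normRpow_mul hφ ((N - 4 - γ) / 2)
  rw [rellichEnergy_eq hN0 (by ring) hv, gradientEnergy_eq hN0 (by ring) hv]
  set P := polarCalculus N
  have hv' : v ∈ P.S := hv
  have h0 := P.I_mul_self_nonneg _ hv'
  have h1 := P.I_mul_self_nonneg _ (P.E_mem hv')
  have h2 : 0 ≤ ∑ i, P.I (P.D i v * P.D i v) :=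
    Finset.sum_nonneg fun i _ => P.I_mul_self_nonneg _ (P.D_mem i hv')
  have h3 := P.I_mul_self_nonneg _ (P.E_mem (P.E_mem hv'))
  have h4 := P.I_mul_self_nonneg _ (P.Λ_mem hv')
  have h5 : 0 ≤ ∑ i, P.I (P.D i (P.E v) * P.D i (P.E v)) :=
    Finset.sum_nonneg fun i _ => P.I_mul_self_nonneg _ (P.D_mem i (P.E_mem hv'))
  set a := ((N : ℝ) - 4 - γ) / 2 with ha
  have ha0 : 1 / 2 ≤ a := by rw [ha]; linarith
  have hb0 : 1 ≤ (N : ℝ) - 2 - a := by rw [ha]; linarith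
  have hab : 1 / 2 ≤ a * (N - 2 - a) := by nlinarith
  have hab2 : 1 / 4 * a ^ 2 ≤ (a * (N - 2 - a)) ^ 2 := by
    rw [mul_pow]
    nlinarith [sq_nonneg a, one_le_pow₀ hb0 (n := 2)]
  have e1 := mul_le_mul_of_nonneg_right hab2 h0
  have e2 := mul_le_mul_of_nonneg_right hab h1
  have e3 := mul_le_mul_of_nonneg_right hab h2
  have e4 : 0 ≤ (2 + γ) ^ 2 * P.I (P.E v * P.E v) := by positivity
  linarith

/-- The Hardy-Rellich inequality with a remainder: the deficit is nonnegative, and it controls a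
weighted `L²` norm of `φ`. The remainder is continuous in the weighted `L²` norms and thus survives
the passage to the completion, where it gives strictness. -/
lemma IsPuncturedTestFun.localisedHardyEnergy_le (hN : 5 ≤ N) (hγ : -2 < γ) (hγ' : γ ≤ 0)
    (hφ : IsPuncturedTestFun φ) :
    0 ≤ hardyRellichSum γ φ (Laplacian.laplacian φ)
        - hardyRellichConst N γ * gradientEnergy γ (gradient φ) ∧
    localisedHardyEnergy γ φ ^ 4 ≤ hardyEnergy γ φ ^ 3 *
      (hardyRellichSum γ φ (Laplacian.laplacian φ)
        - hardyRellichConst N γ * gradientEnergy γ (gradient φ)) := by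
  have hN0 : N ≠ 0 := by omega
  have hN' : (5 : ℝ) ≤ N := by exact_mod_cast hN
  obtain ⟨v, hv, rfl⟩ := exists_eq_normRpow_mul hφ ((N - 4 - γ) / 2)
  rw [hardyRellich_identity hN0 (by ring) hv, hardyEnergy_eq hN0 (by ring) hv]
  have hJ := localisedHardyEnergy_eq (γ := γ) (a := (N - 4 - γ) / 2) hN0 (by ring) hv
  set J := localisedHardyEnergy γ (normRpow (-(((N : ℝ) - 4 - γ) / 2)) * v).ext
  set P := polarCalculus N
  have hv' : v ∈ P.S := hv
  have h0 := P.I_mul_self_nonneg _ hv'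
  have h3 := P.I_mul_self_nonneg _ (P.E_mem (P.E_mem hv'))
  have h2 : 0 ≤ ∑ i, P.I (P.D i v * P.D i v) :=
    Finset.sum_nonneg fun i _ => P.I_mul_self_nonneg _ (P.D_mem i hv')
  have h5 : 0 ≤ ∑ i, P.I (P.D i (P.E v) * P.D i (P.E v)) :=
    Finset.sum_nonneg fun i _ => P.I_mul_self_nonneg _ (P.D_mem i (P.E_mem hv'))
  have hgap := P.spectral_gap (by omega) hv'
  -- `(2 + γ)² ≤ 4 ≤ N - 1`: the spectral gap absorbs the negative angular term
  have hcoef : (2 + γ) ^ 2 ≤ (N : ℝ) - 1 := by nlinarith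
  have h6 := mul_le_mul_of_nonneg_right hcoef h2
  have h7 := P.I_E_mul_sq_le hv' (invariantIntegral_saturation_le hv)
  rw [← hJ] at h7
  have hle : P.I (P.E (P.E v) * P.E (P.E v)) ≤ P.I (P.E (P.E v) * P.E (P.E v))
      + 2 * ∑ i, P.I (P.D i (P.E v) * P.D i (P.E v))
      + (P.I (P.Λ v * P.Λ v) - (2 + γ) ^ 2 * ∑ i, P.I (P.D i v * P.D i v)) := by linarith
  refine ⟨h3.trans hle, ?_⟩
  calc J ^ 4 = (2 * J) ^ 4 / 16 := by ring
    _ ≤ (16 * P.I (v * v) ^ 3 * P.I (P.E (P.E v) * P.E (P.E v))) / 16 := by gcongr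
    _ = P.I (v * v) ^ 3 * P.I (P.E (P.E v) * P.E (P.E v)) := by ring
    _ ≤ _ := by gcongr

end TestFunctions

/-! ### The closure of the test functions in the weighted `L²` spaces -/

section LTwo

variable {α F : Type*} [MeasurableSpace α] {μ : Measure α} [NormedAddCommGroup F]
  [InnerProductSpace ℝ F]

lemma MeasureTheory.Lp.norm_sq_eq_integral {f : Lp F 2 μ} {g : α → F} (h : f =ᵐ[μ] g) :
    ‖f‖ ^ 2 = ∫ x, ‖g x‖ ^ 2 ∂μ := by
  rw [← real_inner_self_eq_norm_sq, L2.inner_def]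
  refine integral_congr_ae ?_
  filter_upwards [h] with x hx
  rw [hx, real_inner_self_eq_norm_sq]

lemma MeasureTheory.Lp.integrable_norm_sq {f : Lp F 2 μ} {g : α → F} (h : f =ᵐ[μ] g) :
    Integrable (fun x => ‖g x‖ ^ 2) μ := by
  refine (L2.integrable_inner (𝕜 := ℝ) f f).congr ?_
  filter_upwards [h] with x hx
  rw [hx, real_inner_self_eq_norm_sq]

lemma MeasureTheory.Lp.inner_eq_integral {f g : Lp F 2 μ} {f' g' : α → F} (hf : f =ᵐ[μ] f')
    (hg : g =ᵐ[μ] g') :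
    inner ℝ f g = ∫ x, inner ℝ (f' x) (g' x) ∂μ := by
  rw [L2.inner_def]
  refine integral_congr_ae ?_
  filter_upwards [hf, hg] with x hx hy
  rw [hx, hy]

end LTwo

variable (N) in
/-- The space of triples (Laplacian, gradient, function) of square integrable functions. -/
abbrev EnergySpace : Type :=
  Lp ℝ 2 (volume : Measure (RN N)) × Lp (RN N) 2 (volume : Measure (RN N)) ×
    Lp ℝ 2 (volume : Measure (RN N))

/-- `p` consists of the functions `|x|^{-γ/2} L`, `|x|^{-γ/2-1} G`, `|x|^{-γ/2-2} u`, whose `L²`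
norms squared are the three energies of the inequality. -/
structure Represents (γ : ℝ) (p : EnergySpace N) (u : RN N → ℝ) (G : RN N → RN N)
    (L : RN N → ℝ) : Prop where
  laplacian : p.1 =ᵐ[volume] fun x => ‖x‖ ^ (-γ / 2) • L x
  gradient : p.2.1 =ᵐ[volume] fun x => ‖x‖ ^ (-γ / 2 - 1) • G x
  function : p.2.2 =ᵐ[volume] fun x => ‖x‖ ^ (-γ / 2 - 2) • u x

lemma norm_norm_rpow_smul_sq {F : Type*} [NormedAddCommGroup F] [NormedSpace ℝ F] (s : ℝ)
    {x : RN N} (hx : x ≠ 0) (y : F) :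
    ‖‖x‖ ^ s • y‖ ^ 2 = ‖x‖ ^ (2 * s) * ‖y‖ ^ 2 := by
  rw [norm_smul, mul_pow, Real.norm_of_nonneg (by positivity), ← Real.rpow_mul_natCast (by simp)]
  congr 2
  push_cast
  ring

namespace Represents

variable {γ : ℝ} {p q : EnergySpace N} {u u' L L' : RN N → ℝ} {G G' : RN N → RN N}

lemma sub (h : Represents γ p u G L) (h' : Represents γ q u' G' L') :
    Represents γ (p - q) (fun x => u x - u' x) (fun x => G x - G' x) (fun x => L x - L' x) where
  laplacian := by
    filter_upwards [Lp.coeFn_sub p.1 q.1, h.laplacian, h'.laplacian] with x hx h1 h2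
    rw [Prod.fst_sub, hx, Pi.sub_apply, h1, h2, smul_sub]
  gradient := by
    filter_upwards [Lp.coeFn_sub p.2.1 q.2.1, h.gradient, h'.gradient] with x hx h1 h2
    rw [Prod.snd_sub, Prod.fst_sub, hx, Pi.sub_apply, h1, h2, smul_sub]
  function := by
    filter_upwards [Lp.coeFn_sub p.2.2 q.2.2, h.function, h'.function] with x hx h1 h2
    rw [Prod.snd_sub, Prod.snd_sub, hx, Pi.sub_apply, h1, h2, smul_sub]

lemma congr (h : Represents γ p u G L) (hu : u' =ᵐ[volume] u) (hG : G' =ᵐ[volume] G)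
    (hL : L' =ᵐ[volume] L) : Represents γ p u' G' L' where
  laplacian := by
    filter_upwards [h.laplacian, hL] with x h1 h2
    rw [h1, h2]
  gradient := by
    filter_upwards [h.gradient, hG] with x h1 h2
    rw [h1, h2]
  function := by
    filter_upwards [h.function, hu] with x h1 h2
    rw [h1, h2]

lemma rellich_congr (hN : N ≠ 0) : (fun x => ‖‖x‖ ^ (-γ / 2) • L x‖ ^ 2) =ᵐ[volume]
    fun x : RN N => ‖x‖ ^ (-γ) * (L x) ^ 2 := by
  filter_upwards [PuncturedSmooth.ae_ne_zero hN] with x hx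
  rw [norm_norm_rpow_smul_sq _ hx, Real.norm_eq_abs, sq_abs, show 2 * (-γ / 2) = -γ by ring]

lemma gradient_congr (hN : N ≠ 0) : (fun x => ‖‖x‖ ^ (-γ / 2 - 1) • G x‖ ^ 2) =ᵐ[volume]
    fun x : RN N => ‖x‖ ^ (-γ - 2) * ‖G x‖ ^ 2 := by
  filter_upwards [PuncturedSmooth.ae_ne_zero hN] with x hx
  rw [norm_norm_rpow_smul_sq _ hx, show 2 * (-γ / 2 - 1) = -γ - 2 by ring]

lemma hardy_congr (hN : N ≠ 0) : (fun x => ‖‖x‖ ^ (-γ / 2 - 2) • u x‖ ^ 2) =ᵐ[volume]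
    fun x : RN N => ‖x‖ ^ (-γ - 4) * (u x) ^ 2 := by
  filter_upwards [PuncturedSmooth.ae_ne_zero hN] with x hx
  rw [norm_norm_rpow_smul_sq _ hx, Real.norm_eq_abs, sq_abs,
    show 2 * (-γ / 2 - 2) = -γ - 4 by ring]

lemma rellichEnergy_eq (hN : N ≠ 0) (h : Represents γ p u G L) :
    rellichEnergy γ L = ‖p.1‖ ^ 2 := by
  rw [Lp.norm_sq_eq_integral h.laplacian, integral_congr_ae (rellich_congr hN), rellichEnergy]

lemma gradientEnergy_eq (hN : N ≠ 0) (h : Represents γ p u G L) :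
    gradientEnergy γ G = ‖p.2.1‖ ^ 2 := by
  rw [Lp.norm_sq_eq_integral h.gradient, integral_congr_ae (gradient_congr hN), gradientEnergy]

lemma hardyEnergy_eq (hN : N ≠ 0) (h : Represents γ p u G L) :
    hardyEnergy γ u = ‖p.2.2‖ ^ 2 := by
  rw [Lp.norm_sq_eq_integral h.function, integral_congr_ae (hardy_congr hN), hardyEnergy]

lemma integrable_rellich (hN : N ≠ 0) (h : Represents γ p u G L) :
    Integrable fun x => ‖x‖ ^ (-γ) * (L x) ^ 2 :=
  (Lp.integrable_norm_sq h.laplacian).congr (rellich_congr hN)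

lemma integrable_gradient (hN : N ≠ 0) (h : Represents γ p u G L) :
    Integrable fun x => ‖x‖ ^ (-γ - 2) * ‖G x‖ ^ 2 :=
  (Lp.integrable_norm_sq h.gradient).congr (gradient_congr hN)

lemma integrable_hardy (hN : N ≠ 0) (h : Represents γ p u G L) :
    Integrable fun x => ‖x‖ ^ (-γ - 4) * (u x) ^ 2 :=
  (Lp.integrable_norm_sq h.function).congr (hardy_congr hN)

lemma function_eq_zero_iff (hN : N ≠ 0) (h : Represents γ p u G L) :
    p.2.2 = 0 ↔ u =ᵐ[volume] 0 := by
  rw [Lp.eq_zero_iff_ae_eq_zero]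
  constructor
  · intro h0
    filter_upwards [h0, h.function, PuncturedSmooth.ae_ne_zero hN] with x h1 h2 hx
    rw [h1, Pi.zero_apply] at h2
    have hpos : 0 < ‖x‖ := norm_pos_iff.2 hx
    exact (smul_eq_zero.1 h2.symm).resolve_left (by positivity)
  · intro h0
    filter_upwards [h0, h.function] with x h1 h2
    rw [h2, h1, Pi.zero_apply, smul_zero]

end Represents

/-- The closure, in the weighted `L²` norms, of the triples `(Δφ, ∇φ, φ)` of the test functions `φ`
with support away from the origin. -/
def energyClosure (N : ℕ) (γ : ℝ) : Set (EnergySpace N) :=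
  closure {p | ∃ φ, IsPuncturedTestFun φ ∧
    Represents γ p φ (gradient φ) (Laplacian.laplacian φ)}

namespace energyClosure

variable {γ : ℝ} {p : EnergySpace N}

/-- A closed condition holds on the closure as soon as it holds for the triples of test functions.
-/
lemma induction {C : Set (EnergySpace N)} (hC : IsClosed C)
    (h : ∀ φ p, IsPuncturedTestFun φ → Represents γ p φ (gradient φ) (Laplacian.laplacian φ) →
      p ∈ C) (hp : p ∈ energyClosure N γ) : p ∈ C :=
  closure_minimal (by rintro q ⟨φ, hφ, hr⟩; exact h φ q hφ hr) hC hp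

lemma hardy_le (hN : N ≠ 0) (hp : p ∈ energyClosure N γ) :
    ((N - 4 - γ) / 2) ^ 2 * ‖p.2.2‖ ^ 2 ≤ ‖p.2.1‖ ^ 2 := by
  refine induction (C := {p | ((N - 4 - γ) / 2) ^ 2 * ‖p.2.2‖ ^ 2 ≤ ‖p.2.1‖ ^ 2})
    (isClosed_le (by fun_prop) (by fun_prop)) (fun φ p hφ hr => ?_) hp
  have := hφ.hardy_le (γ := γ) hN
  rwa [hr.hardyEnergy_eq hN, hr.gradientEnergy_eq hN] at this

lemma rellich_le (hN : 5 ≤ N) (hγ : -2 < γ) (hγ' : γ ≤ 0) (hp : p ∈ energyClosure N γ) :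
    (1 / 4) * ‖p.2.1‖ ^ 2 ≤ ‖p.1‖ ^ 2 := by
  have hN0 : N ≠ 0 := by omega
  refine induction (C := {p | (1 / 4) * ‖p.2.1‖ ^ 2 ≤ ‖p.1‖ ^ 2})
    (isClosed_le (by fun_prop) (by fun_prop)) (fun φ p hφ hr => ?_) hp
  have := hφ.rellich_le (γ := γ) hN hγ hγ'
  rwa [hr.gradientEnergy_eq hN0, hr.rellichEnergy_eq hN0] at this

lemma hardyRellich_le (hN : 5 ≤ N) (hγ : -2 < γ) (hγ' : γ ≤ 0) (hp : p ∈ energyClosure N γ) :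
    hardyRellichConst N γ * ‖p.2.1‖ ^ 2 ≤
      ‖p.1‖ ^ 2 + (((N : ℝ) - 4 - γ) / 2) ^ 4 * ‖p.2.2‖ ^ 2 := by
  have hN0 : N ≠ 0 := by omega
  refine induction (C := {p | hardyRellichConst N γ * ‖p.2.1‖ ^ 2 ≤
      ‖p.1‖ ^ 2 + (((N : ℝ) - 4 - γ) / 2) ^ 4 * ‖p.2.2‖ ^ 2})
    (isClosed_le (by fun_prop) (by fun_prop)) (fun φ p hφ hr => ?_) hp
  have := (hφ.localisedHardyEnergy_le (γ := γ) hN hγ hγ').1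
  rw [hardyRellichSum, hr.gradientEnergy_eq hN0, hr.rellichEnergy_eq hN0,
    hr.hardyEnergy_eq hN0] at this
  exact sub_nonneg.1 this

/-- Equality forces the function to vanish: along an approximating sequence the deficits tend to
`0`, hence so do the localised Hardy energies. -/
lemma function_eq_zero_of_eq (hN : 5 ≤ N) (hγ : -2 < γ) (hγ' : γ ≤ 0)
    (hp : p ∈ energyClosure N γ) (heq : ‖p.1‖ ^ 2 + (((N : ℝ) - 4 - γ) / 2) ^ 4 * ‖p.2.2‖ ^ 2 =
      hardyRellichConst N γ * ‖p.2.1‖ ^ 2) : p.2.2 = 0 := by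
  have hN0 : N ≠ 0 := by omega
  obtain ⟨P, hP, hlim⟩ := mem_closure_iff_seq_limit.1 hp
  choose φ hφ hr using hP
  set w : RN N → ℝ := fun x => ‖x‖ ^ 2 / (1 + ‖x‖ ^ 2) ^ 2 with hw
  have hw0 : ∀ x, 0 ≤ w x := fun x => by positivity
  have hw1 : ∀ x, w x ≤ 1 := fun x => by
    rw [hw]
    refine (div_le_one (by positivity)).2 ?_
    nlinarith [sq_nonneg (‖x‖ ^ 2), sq_nonneg ‖x‖]
  have hwc : Continuous w := by
    refine (by fun_prop : Continuous fun x : RN N => ‖x‖ ^ 2).div (by fun_prop)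
      fun x => by positivity
  have hint : ∀ f : Lp ℝ 2 (volume : Measure (RN N)), Integrable (fun x => f x ^ 2) := fun f => by
    simpa using Lp.integrable_norm_sq (f := f) (EventuallyEq.refl _ _)
  have hintw : ∀ f : Lp ℝ 2 (volume : Measure (RN N)), Integrable (fun x => w x * f x ^ 2) :=
    fun f => (hint f).mono' (hwc.aestronglyMeasurable.mul (hint f).aestronglyMeasurable)
      (Eventually.of_forall fun x => by
        rw [Real.norm_of_nonneg (mul_nonneg (hw0 x) (sq_nonneg _))]
        exact mul_le_of_le_one_left (sq_nonneg _) (hw1 x))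
  have hJ : ∀ n, localisedHardyEnergy γ (φ n) = ∫ x, w x * (P n).2.2 x ^ 2 := by
    intro n
    refine integral_congr_ae ?_
    filter_upwards [(hr n).function, Represents.hardy_congr (γ := γ) (u := φ n) hN0] with x h1 h2
    rw [h1, ← h2, Real.norm_eq_abs, sq_abs, mul_comm]
  have hJlim : Tendsto (fun n => ∫ x, w x * (P n).2.2 x ^ 2) atTop (𝓝 0) := by
    have h1 : Tendsto (fun n => (‖(P n).2.2‖ ^ 2) ^ 3 *
        (‖(P n).1‖ ^ 2 + (((N : ℝ) - 4 - γ) / 2) ^ 4 * ‖(P n).2.2‖ ^ 2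
          - hardyRellichConst N γ * ‖(P n).2.1‖ ^ 2)) atTop (𝓝 0) := by
      have hc : Continuous fun q : EnergySpace N => (‖q.2.2‖ ^ 2) ^ 3 *
        (‖q.1‖ ^ 2 + (((N : ℝ) - 4 - γ) / 2) ^ 4 * ‖q.2.2‖ ^ 2
          - hardyRellichConst N γ * ‖q.2.1‖ ^ 2) := by fun_prop
      have := (hc.tendsto p).comp hlim
      rwa [heq, sub_self, mul_zero] at this
    have h4 : Tendsto (fun n => (∫ x, w x * (P n).2.2 x ^ 2) ^ 4) atTop (𝓝 0) := by
      refine squeeze_zero (fun n => by positivity) (fun n => ?_) h1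
      have := ((hφ n).localisedHardyEnergy_le (γ := γ) hN hγ hγ').2
      rwa [hJ, hardyRellichSum, (hr n).gradientEnergy_eq hN0, (hr n).rellichEnergy_eq hN0,
        (hr n).hardyEnergy_eq hN0] at this
    have h5 := h4.sqrt.sqrt
    simp only [Real.sqrt_zero] at h5
    refine h5.congr fun n => ?_
    have hnn : 0 ≤ ∫ x, w x * (P n).2.2 x ^ 2 :=
      integral_nonneg fun x => mul_nonneg (hw0 x) (sq_nonneg _)
    rw [show (∫ x, w x * (P n).2.2 x ^ 2) ^ 4 = ((∫ x, w x * (P n).2.2 x ^ 2) ^ 2) ^ 2 by ring,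
      Real.sqrt_sq (by positivity), Real.sqrt_sq hnn]
  have hle : ∀ n, ∫ x, w x * p.2.2 x ^ 2 ≤
      2 * (∫ x, w x * (P n).2.2 x ^ 2) + 2 * ‖p.2.2 - (P n).2.2‖ ^ 2 := by
    intro n
    rw [Lp.norm_sq_eq_integral (Lp.coeFn_sub p.2.2 (P n).2.2), ← integral_const_mul,
      ← integral_const_mul, ← integral_add ((hintw _).const_mul 2)
        ((Lp.integrable_norm_sq (Lp.coeFn_sub p.2.2 (P n).2.2)).const_mul 2)]
    refine integral_mono (hintw _) (((hintw _).const_mul 2).add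
      ((Lp.integrable_norm_sq (Lp.coeFn_sub p.2.2 (P n).2.2)).const_mul 2)) fun x => ?_
    simp only [Pi.sub_apply, Real.norm_eq_abs, sq_abs]
    nlinarith [hw0 x, hw1 x, mul_nonneg (hw0 x) (sq_nonneg (p.2.2 x - 2 * (P n).2.2 x)),
      mul_nonneg (sub_nonneg.2 (hw1 x)) (sq_nonneg (p.2.2 x - (P n).2.2 x))]
  have hzero : ∫ x, w x * p.2.2 x ^ 2 ≤ 0 := by
    have h1 : Tendsto (fun n => ‖p.2.2 - (P n).2.2‖ ^ 2) atTop (𝓝 0) := by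
      have hc : Continuous fun q : EnergySpace N => ‖p.2.2 - q.2.2‖ ^ 2 := by fun_prop
      have := (hc.tendsto p).comp hlim
      simp only [sub_self, norm_zero, ne_eq, OfNat.ofNat_ne_zero, not_false_eq_true,
        zero_pow] at this
      exact this
    have h2 := (hJlim.const_mul 2).add (h1.const_mul 2)
    simp only [mul_zero, add_zero] at h2
    exact ge_of_tendsto' h2 hle
  have hae := (integral_eq_zero_iff_of_nonneg
    (fun x => mul_nonneg (hw0 x) (sq_nonneg (p.2.2 x))) (hintw _)).1
      (le_antisymm hzero (integral_nonneg fun x => mul_nonneg (hw0 x) (sq_nonneg _)))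
  rw [Lp.eq_zero_iff_ae_eq_zero]
  filter_upwards [hae, PuncturedSmooth.ae_ne_zero hN0] with x hx hx0
  have hpos : 0 < ‖x‖ := norm_pos_iff.2 hx0
  have hwx : w x ≠ 0 := by
    simp only [hw]
    positivity
  exact pow_eq_zero_iff (two_ne_zero) |>.1 ((mul_eq_zero.1 hx).resolve_left hwx)

end energyClosure

/-! ### Cutting off near the origin -/

/-- A function with bounded support and a singularity of order `s > -N / 2` is in `L²`. -/
lemma memLp_two_of_norm_le_rpow {F : Type*} [NormedAddCommGroup F] [InnerProductSpace ℝ F]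
    (hN : N ≠ 0) {s C R : ℝ} (hs : -(N : ℝ) < 2 * s) {f : RN N → F}
    (hf : AEStronglyMeasurable f) (hb : ∀ x ≠ 0, ‖f x‖ ≤ C * ‖x‖ ^ s)
    (hR : ∀ x, R ≤ ‖x‖ → f x = 0) : MemLp f 2 := by
  rw [memLp_two_iff_integrable_sq_norm hf]
  have h := integrableOn_ball_of_norm_le_rpow (E := RN N) (μ := volume) (f := fun x => ‖f x‖ ^ 2)
    (C := C ^ 2) (α := -(2 * s)) (r := R) (by simp; omega) (by simp; linarith)
    (ae_restrict_of_ae (by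
      filter_upwards [PuncturedSmooth.ae_ne_zero hN] with x hx
      rw [Real.norm_of_nonneg (by positivity), neg_neg, mul_comm 2 s, Real.rpow_mul (norm_nonneg _),
        Real.rpow_ofNat, ← mul_pow]
      exact pow_le_pow_left₀ (norm_nonneg _) (hb x hx) 2)) (hf.norm.pow 2)
  refine (integrableOn_iff_integrable_of_support_subset fun x hx => ?_).1 h
  rw [mem_ball_zero_iff]
  by_contra hle
  exact hx (by simp [hR x (not_lt.1 hle)])

/-- Dominated convergence to `0` in `L²`. -/
lemma MeasureTheory.Lp.tendsto_zero_of_dominated {α F : Type*} [MeasurableSpace α] {μ : Measure α}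
    [NormedAddCommGroup F] [InnerProductSpace ℝ F] {P : ℕ → Lp F 2 μ} {f : ℕ → α → F}
    (hP : ∀ n, P n =ᵐ[μ] f n) {b : α → ℝ} (hb : MemLp b 2 μ)
    (hfb : ∀ n, ∀ᵐ x ∂μ, ‖f n x‖ ≤ b x) (hf : ∀ᵐ x ∂μ, Tendsto (fun n => f n x) atTop (𝓝 0)) :
    Tendsto P atTop (𝓝 0) := by
  have h : Tendsto (fun n => ∫ x, ‖f n x‖ ^ 2 ∂μ) atTop (𝓝 (∫ _, 0 ∂μ)) := by
    refine tendsto_integral_of_dominated_convergence (fun x => b x ^ 2)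
      (fun n => (Lp.integrable_norm_sq (hP n)).aestronglyMeasurable) hb.integrable_sq
      (fun n => ?_) ?_
    · filter_upwards [hfb n] with x hx
      rw [Real.norm_of_nonneg (by positivity)]
      exact pow_le_pow_left₀ (norm_nonneg _) hx 2
    · filter_upwards [hf] with x hx
      simpa using hx.norm.pow 2
  rw [tendsto_zero_iff_norm_tendsto_zero]
  have h' := h.sqrt
  simp only [integral_zero, Real.sqrt_zero] at h'
  refine h'.congr fun n => ?_
  rw [← Lp.norm_sq_eq_integral (hP n), Real.sqrt_sq (norm_nonneg _)]

namespace IsTestFun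

variable {φ ψ : RN N → ℝ}

lemma sub (hφ : IsTestFun φ) (hψ : IsTestFun ψ) : IsTestFun fun x => φ x - ψ x :=
  ⟨hφ.1.sub hψ.1, hφ.2.sub hψ.2⟩

lemma mul (hφ : IsTestFun φ) (hψ : IsTestFun ψ) : IsTestFun fun x => φ x * ψ x :=
  ⟨hφ.1.mul hψ.1, hφ.2.mul_right⟩

lemma differentiableAt (hφ : IsTestFun φ) (x : RN N) : DifferentiableAt ℝ φ x :=
  hφ.1.contDiffAt.differentiableAt (by simp)

lemma laplacian_eq (hφ : IsTestFun φ) :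
    Laplacian.laplacian φ = fun x => ∑ i, _root_.partialDeriv i (_root_.partialDeriv i φ) x :=
  funext fun _ => laplacian_eq_sum_partialDeriv hφ.1.contDiffAt

lemma partialDeriv_sub (hφ : IsTestFun φ) (hψ : IsTestFun ψ) (i : Fin N) :
    _root_.partialDeriv i (fun x => φ x - ψ x) =
      fun x => _root_.partialDeriv i φ x - _root_.partialDeriv i ψ x := by
  funext x
  simp only [_root_.partialDeriv]
  rw [fderiv_fun_sub (hφ.differentiableAt x) (hψ.differentiableAt x)]
  rfl

lemma laplacian_sub (hφ : IsTestFun φ) (hψ : IsTestFun ψ) :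
    Laplacian.laplacian (fun x => φ x - ψ x) =
      fun x => Laplacian.laplacian φ x - Laplacian.laplacian ψ x := by
  rw [(hφ.sub hψ).laplacian_eq, hφ.laplacian_eq, hψ.laplacian_eq]
  funext x
  simp only [hφ.partialDeriv_sub hψ, (hφ.partialDeriv _).partialDeriv_sub (hψ.partialDeriv _),
    Finset.sum_sub_distrib]

lemma gradient_sub (hφ : IsTestFun φ) (hψ : IsTestFun ψ) :
    gradient (fun x => φ x - ψ x) = fun x => gradient φ x - gradient ψ x := by
  funext x
  ext i
  rw [PiLp.sub_apply, gradient_apply, gradient_apply, gradient_apply, hφ.partialDeriv_sub hψ]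

lemma continuous_gradient (hφ : IsTestFun φ) : Continuous (gradient φ) :=
  (LinearIsometryEquiv.continuous _).comp (hφ.1.continuous_fderiv (by simp))

lemma continuous_laplacian (hφ : IsTestFun φ) : Continuous (Laplacian.laplacian φ) := by
  rw [hφ.laplacian_eq]
  exact continuous_finsetSum _ fun i _ => ((hφ.partialDeriv i).partialDeriv i).1.continuous

lemma exists_eq_zero_of_le_norm (hφ : IsTestFun φ) : ∃ R, ∀ x, R ≤ ‖x‖ → φ =ᶠ[𝓝 x] 0 := by
  obtain ⟨R, hR⟩ := hφ.2.isCompact.isBounded.exists_norm_le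
  refine ⟨R + 1, fun x hx => notMem_tsupport_iff_eventuallyEq.1 fun h => ?_⟩
  linarith [hR x h]

end IsTestFun

lemma eventuallyEq_zero_laplacian {φ : RN N → ℝ} {x : RN N} (h : φ =ᶠ[𝓝 x] 0) :
    Laplacian.laplacian φ x = 0 := by
  have h' : φ =ᶠ[𝓝 x] fun _ => (0 : ℝ) := h
  rw [(InnerProductSpace.laplacian_congr_nhds h').eq_of_nhds, InnerProductSpace.laplacian_const]
  rfl

lemma eventuallyEq_zero_gradient {φ : RN N → ℝ} {x : RN N} (h : φ =ᶠ[𝓝 x] 0) :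
    gradient φ x = 0 := by
  rw [gradient, h.fderiv_eq]
  simp

/-- Bounds on `φ`, `|x| ∂ᵢφ` and `|x|² ∂ᵢ²φ`. They are invariant under dilations, hence uniform in
the cutoff functions `x ↦ β (k x)`. -/
structure IsScaleBounded (M : ℝ) (φ : RN N → ℝ) : Prop where
  zeroth : ∀ x, |φ x| ≤ M
  first : ∀ i x, ‖x‖ * |partialDeriv i φ x| ≤ M
  second : ∀ i x, ‖x‖ ^ 2 * |partialDeriv i (partialDeriv i φ) x| ≤ M

lemma IsTestFun.exists_isScaleBounded {φ : RN N → ℝ} (hφ : IsTestFun φ) :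
    ∃ M, IsScaleBounded M φ := by
  have h : ∀ {ψ : RN N → ℝ} (k : ℕ), IsTestFun ψ → ∃ M, ∀ x, ‖x‖ ^ k * |ψ x| ≤ M := by
    intro ψ k hψ
    obtain ⟨M, hM⟩ := Continuous.bounded_above_of_compact_support
      (f := fun x => ‖x‖ ^ k * ψ x) (by have := hψ.1.continuous; fun_prop) hψ.2.mul_left
    refine ⟨M, fun x => ?_⟩
    have := hM x
    rwa [norm_mul, Real.norm_of_nonneg (by positivity), Real.norm_eq_abs] at this
  obtain ⟨M₀, h₀⟩ := h 0 hφ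
  choose M₁ h₁ using fun i => h 1 (hφ.partialDeriv i)
  choose M₂ h₂ using fun i => h 2 ((hφ.partialDeriv i).partialDeriv i)
  have hM₀ : 0 ≤ M₀ := le_trans (by positivity) (h₀ 0)
  have hM₁ : ∀ i, 0 ≤ M₁ i := fun i => le_trans (by positivity) (h₁ i 0)
  have hM₂ : ∀ i, 0 ≤ M₂ i := fun i => le_trans (by positivity) (h₂ i 0)
  have s₁ := Finset.sum_nonneg fun i (_ : i ∈ Finset.univ) => hM₁ i
  have s₂ := Finset.sum_nonneg fun i (_ : i ∈ Finset.univ) => hM₂ i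
  refine ⟨M₀ + ∑ i, M₁ i + ∑ i, M₂ i, fun x => ?_, fun i x => ?_, fun i x => ?_⟩
  · have := h₀ x
    rw [pow_zero, one_mul] at this
    linarith
  · have := h₁ i x
    rw [pow_one] at this
    have := Finset.single_le_sum (fun i _ => hM₁ i) (Finset.mem_univ i)
    linarith
  · have := h₂ i x
    have := Finset.single_le_sum (fun i _ => hM₂ i) (Finset.mem_univ i)
    linarith

lemma partialDeriv_comp_smul (φ : RN N → ℝ) (c : ℝ) (i : Fin N) :
    partialDeriv i (fun x => φ (c • x)) = fun x => c * partialDeriv i φ (c • x) := by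
  funext x
  simp [partialDeriv, fderiv_comp_smul]

namespace IsScaleBounded

variable {φ ψ : RN N → ℝ} {M M' : ℝ}

lemma comp_smul (h : IsScaleBounded M φ) (hφ : IsTestFun φ) {c : ℝ} (hc : 0 < c) :
    IsScaleBounded M fun x => φ (c • x) where
  zeroth x := h.zeroth _
  first i x := by
    have := h.first i (c • x)
    rw [norm_smul, Real.norm_of_nonneg hc.le] at this
    rw [partialDeriv_comp_smul, abs_mul, abs_of_pos hc]
    linarith
  second i x := by
    have := h.second i (c • x)
    rw [norm_smul, Real.norm_of_nonneg hc.le] at this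
    have h2 : partialDeriv i (fun x => c * partialDeriv i φ (c • x)) x =
        c * (c * partialDeriv i (partialDeriv i φ) (c • x)) := by
      have h3 := congrFun (partialDeriv_comp_smul (partialDeriv i φ) c i) x
      rw [← h3, partialDeriv, partialDeriv, fderiv_const_mul]
      · rfl
      · exact ((hφ.partialDeriv i).differentiableAt (c • x)).comp x (by fun_prop)
    rw [partialDeriv_comp_smul, h2, abs_mul, abs_mul, abs_of_pos hc]
    linarith

lemma mul (h : IsScaleBounded M φ) (h' : IsScaleBounded M' ψ) (hφ : IsTestFun φ)
    (hψ : IsTestFun ψ) : IsScaleBounded (4 * (M * M')) fun x => φ x * ψ x := by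
  have hM : ∀ x : RN N, 0 ≤ M := fun x => (abs_nonneg _).trans (h.zeroth x)
  have hM' : ∀ x : RN N, 0 ≤ M' := fun x => (abs_nonneg _).trans (h'.zeroth x)
  have key : ∀ (x : RN N) {s t : ℝ}, 0 ≤ s → 0 ≤ t → s ≤ M → t ≤ M' → s * t ≤ M * M' :=
    fun x s t hs ht hs' ht' => mul_le_mul hs' ht' ht (hM x)
  have hd : ∀ i, partialDeriv i (fun x => φ x * ψ x) =
      fun x => φ x * partialDeriv i ψ x + ψ x * partialDeriv i φ x := fun i =>
    funext fun x => partialDeriv_mul (hφ.differentiableAt x) (hψ.differentiableAt x) i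
  refine ⟨fun x => ?_, fun i x => ?_, fun i x => ?_⟩
  · rw [abs_mul]
    have := key x (abs_nonneg _) (abs_nonneg _) (h.zeroth x) (h'.zeroth x)
    have := mul_nonneg (hM x) (hM' x)
    linarith
  · have k1 := key x (abs_nonneg _) (by positivity) (h.zeroth x) (h'.first i x)
    have k2 := key x (by positivity) (abs_nonneg _) (h.first i x) (h'.zeroth x)
    have := mul_nonneg (hM x) (hM' x)
    rw [hd]
    calc _ ≤ ‖x‖ * (|φ x * partialDeriv i ψ x| + |ψ x * partialDeriv i φ x|) := by
          gcongr
          exact abs_add_le _ _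
      _ = |φ x| * (‖x‖ * |partialDeriv i ψ x|) + (‖x‖ * |partialDeriv i φ x|) * |ψ x| := by
          rw [abs_mul, abs_mul]
          ring
      _ ≤ _ := by linarith
  · have k1 := key x (abs_nonneg _) (by positivity) (h.zeroth x) (h'.second i x)
    have k2 := key x (by positivity) (by positivity) (h.first i x) (h'.first i x)
    have k3 := key x (by positivity) (abs_nonneg _) (h.second i x) (h'.zeroth x)
    have hdd : partialDeriv i (partialDeriv i (fun x => φ x * ψ x)) x =
        φ x * partialDeriv i (partialDeriv i ψ) x
          + 2 * (partialDeriv i φ x * partialDeriv i ψ x)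
          + ψ x * partialDeriv i (partialDeriv i φ) x := by
      have e1 := partialDeriv_mul (hφ.differentiableAt x) ((hψ.partialDeriv i).differentiableAt x) i
      have e2 := partialDeriv_mul (hψ.differentiableAt x) ((hφ.partialDeriv i).differentiableAt x) i
      rw [hd]
      rw [partialDeriv] at e1 e2 ⊢
      rw [fderiv_fun_add ((hφ.mul (hψ.partialDeriv i)).differentiableAt x)
        ((hψ.mul (hφ.partialDeriv i)).differentiableAt x), add_apply, e1, e2]
      ring
    rw [hdd]
    calc _ ≤ ‖x‖ ^ 2 * (|φ x * partialDeriv i (partialDeriv i ψ) x|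
          + |2 * (partialDeriv i φ x * partialDeriv i ψ x)|
          + |ψ x * partialDeriv i (partialDeriv i φ) x|) := by
          gcongr
          exact abs_add_three _ _ _
      _ = |φ x| * (‖x‖ ^ 2 * |partialDeriv i (partialDeriv i ψ) x|)
          + 2 * ((‖x‖ * |partialDeriv i φ x|) * (‖x‖ * |partialDeriv i ψ x|))
          + (‖x‖ ^ 2 * |partialDeriv i (partialDeriv i φ) x|) * |ψ x| := by
          rw [abs_mul, abs_mul, abs_mul, abs_mul, abs_two]
          ring
      _ ≤ _ := by linarith

lemma norm_weighted_function_le (h : IsScaleBounded M φ) (s : ℝ) (x : RN N) :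
    ‖‖x‖ ^ s • φ x‖ ≤ (N + 1) * M * ‖x‖ ^ s := by
  rw [norm_smul, Real.norm_of_nonneg (by positivity), Real.norm_eq_abs, mul_comm]
  have h0 := h.zeroth x
  have : 0 ≤ M := (abs_nonneg _).trans h0
  have : |φ x| ≤ (N + 1) * M := by nlinarith [mul_nonneg (Nat.cast_nonneg (α := ℝ) N) this]
  gcongr

lemma norm_weighted_gradient_le (h : IsScaleBounded M φ) (s : ℝ) {x : RN N} (hx : x ≠ 0) :
    ‖‖x‖ ^ (s + 1) • gradient φ x‖ ≤ (N + 1) * M * ‖x‖ ^ s := by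
  have hpos : 0 < ‖x‖ := norm_pos_iff.2 hx
  have hM : 0 ≤ M := (abs_nonneg _).trans (h.zeroth x)
  have h1 : ‖gradient φ x‖ ≤ ∑ i, |partialDeriv i φ x| := by
    refine abs_le_of_sq_le_sq' ?_ (Finset.sum_nonneg fun i _ => abs_nonneg _) |>.2
    rw [norm_gradient_sq]
    calc _ = ∑ i, |partialDeriv i φ x| ^ 2 := by simp
      _ ≤ _ := Finset.sum_sq_le_sq_sum_of_nonneg fun i _ => abs_nonneg _
  have h2 : ‖x‖ * ∑ i, |partialDeriv i φ x| ≤ N * M := by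
    rw [Finset.mul_sum]
    simpa using Finset.sum_le_card_nsmul Finset.univ _ M fun i _ => h.first i x
  rw [norm_smul, Real.norm_of_nonneg (by positivity), Real.rpow_add hpos, Real.rpow_one, mul_assoc,
    mul_comm]
  refine mul_le_mul_of_nonneg_right ?_ (by positivity)
  nlinarith

lemma norm_weighted_laplacian_le (h : IsScaleBounded M φ) (hφ : IsTestFun φ) (s : ℝ) {x : RN N}
    (hx : x ≠ 0) : ‖‖x‖ ^ (s + 2) • Laplacian.laplacian φ x‖ ≤ (N + 1) * M * ‖x‖ ^ s := by
  have hpos : 0 < ‖x‖ := norm_pos_iff.2 hx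
  have hM : 0 ≤ M := (abs_nonneg _).trans (h.zeroth x)
  have h2 : ‖x‖ ^ 2 * ∑ i, |partialDeriv i (partialDeriv i φ) x| ≤ N * M := by
    rw [Finset.mul_sum]
    simpa using Finset.sum_le_card_nsmul Finset.univ _ M fun i _ => h.second i x
  have h1 : |Laplacian.laplacian φ x| ≤ ∑ i, |partialDeriv i (partialDeriv i φ) x| := by
    rw [hφ.laplacian_eq]
    exact Finset.abs_sum_le_sum_abs _ _
  rw [norm_smul, Real.norm_of_nonneg (by positivity), Real.rpow_add hpos, Real.rpow_ofNat,
    mul_assoc, mul_comm, Real.norm_eq_abs]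
  refine mul_le_mul_of_nonneg_right ?_ (by positivity)
  nlinarith [mul_le_mul_of_nonneg_left h1 (sq_nonneg ‖x‖)]

end IsScaleBounded

lemma IsTestFun.exists_represents {γ : ℝ} (hN : 5 ≤ N) (hγ' : γ ≤ 0) {φ : RN N → ℝ}
    (hφ : IsTestFun φ) : ∃ p, Represents γ p φ (gradient φ) (Laplacian.laplacian φ) := by
  have hN' : (5 : ℝ) ≤ N := by exact_mod_cast hN
  have hs : -(N : ℝ) < 2 * (-γ / 2 - 2) := by linarith
  obtain ⟨M, hM⟩ := hφ.exists_isScaleBounded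
  obtain ⟨R, hR⟩ := hφ.exists_eq_zero_of_le_norm
  have hm : ∀ s : ℝ, Measurable fun x : RN N => ‖x‖ ^ s := fun s =>
    measurable_norm.pow_const s
  have m1 : MemLp (fun x => ‖x‖ ^ (-γ / 2 - 2 + 2) • Laplacian.laplacian φ x) 2 :=
    memLp_two_of_norm_le_rpow (by omega) hs
      ((hm _).aestronglyMeasurable.smul hφ.continuous_laplacian.aestronglyMeasurable)
      (fun x hx => hM.norm_weighted_laplacian_le hφ _ hx)
      fun x hx => by rw [eventuallyEq_zero_laplacian (hR x hx), smul_zero]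
  have m2 : MemLp (fun x => ‖x‖ ^ (-γ / 2 - 2 + 1) • gradient φ x) 2 :=
    memLp_two_of_norm_le_rpow (by omega) hs
      ((hm _).aestronglyMeasurable.smul hφ.continuous_gradient.aestronglyMeasurable)
      (fun x hx => hM.norm_weighted_gradient_le _ hx)
      fun x hx => by rw [eventuallyEq_zero_gradient (hR x hx), smul_zero]
  have m3 : MemLp (fun x => ‖x‖ ^ (-γ / 2 - 2) • φ x) 2 :=
    memLp_two_of_norm_le_rpow (by omega) hs
      ((hm _).aestronglyMeasurable.smul hφ.1.continuous.aestronglyMeasurable)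
      (fun x _ => hM.norm_weighted_function_le _ x)
      fun x hx => by rw [(hR x hx).eq_of_nhds, Pi.zero_apply, smul_zero]
  refine ⟨(m1.toLp _, m2.toLp _, m3.toLp _), ?_, ?_, m3.coeFn_toLp⟩
  · simpa using m1.coeFn_toLp
  · rw [show -γ / 2 - 1 = -γ / 2 - 2 + 1 by ring]
    exact m2.coeFn_toLp

lemma IsTestFun.represents_sub {γ : ℝ} {p q : EnergySpace N} {φ ψ : RN N → ℝ}
    (hφ : IsTestFun φ) (hψ : IsTestFun ψ)
    (h : Represents γ p φ (gradient φ) (Laplacian.laplacian φ))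
    (h' : Represents γ q ψ (gradient ψ) (Laplacian.laplacian ψ)) :
    Represents γ (p - q) (fun x => φ x - ψ x) (gradient fun x => φ x - ψ x)
      (Laplacian.laplacian fun x => φ x - ψ x) := by
  rw [hφ.gradient_sub hψ, hφ.laplacian_sub hψ]
  exact h.sub h'

/-- Test functions whose support may contain the origin belong to the closure: the cutoff errors
`φ(x) β((k + 1) x)` tend to `0` by dominated convergence, because `|x|^{-γ/2-2}` is locally square
integrable for `N ≥ 5` and `γ ≤ 0`. -/
lemma IsTestFun.mem_energyClosure {γ : ℝ} (hN : 5 ≤ N) (hγ' : γ ≤ 0) {φ : RN N → ℝ}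
    (hφ : IsTestFun φ) {p : EnergySpace N}
    (hp : Represents γ p φ (gradient φ) (Laplacian.laplacian φ)) : p ∈ energyClosure N γ := by
  classical
  have hN0 : N ≠ 0 := by omega
  have hN' : (5 : ℝ) ≤ N := by exact_mod_cast hN
  have hs : -(N : ℝ) < 2 * (-γ / 2 - 2) := by linarith
  let β : ContDiffBump (0 : RN N) := ⟨1, 2, one_pos, one_lt_two⟩
  have hβ : IsTestFun β := ⟨β.contDiff, β.hasCompactSupport⟩
  set ψ : ℕ → RN N → ℝ := fun k x => φ x * β (((k : ℝ) + 1) • x) with hψ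
  have hc : ∀ k : ℕ, (0 : ℝ) < (k : ℝ) + 1 := fun k => by positivity
  have hβk : ∀ k : ℕ, IsTestFun fun x => β (((k : ℝ) + 1) • x) := fun k =>
    ⟨hβ.1.comp (contDiff_const_smul _), hβ.2.comp_smul (hc k).ne'⟩
  have hψt : ∀ k, IsTestFun (ψ k) := fun k => hφ.mul (hβk k)
  -- `ψ k` vanishes outside the ball of radius `2 / (k + 1)`
  have hψ0 : ∀ (k : ℕ) x, 2 < ((k : ℝ) + 1) * ‖x‖ → ψ k =ᶠ[𝓝 x] 0 := by
    intro k x hx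
    have ho : IsOpen {y : RN N | 2 < ((k : ℝ) + 1) * ‖y‖} :=
      isOpen_lt continuous_const (by fun_prop)
    filter_upwards [ho.mem_nhds hx] with y hy
    have : β (((k : ℝ) + 1) • y) = 0 := β.zero_of_le_dist (by
      rw [dist_zero_right, norm_smul, Real.norm_of_nonneg (hc k).le]
      exact le_of_lt hy)
    simp [hψ, this]
  obtain ⟨M, hM⟩ := hφ.exists_isScaleBounded
  obtain ⟨M', hM'⟩ := hβ.exists_isScaleBounded
  have hb : ∀ k, IsScaleBounded (4 * (M * M')) (ψ k) := fun k =>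
    hM.mul (hM'.comp_smul hβ (hc k)) hφ (hβk k)
  choose Q hQ using fun k => (hψt k).exists_represents (γ := γ) hN hγ'
  -- the common dominating function
  set b : RN N → ℝ := (Metric.ball 0 3).indicator fun x =>
    (N + 1) * (4 * (M * M')) * ‖x‖ ^ (-γ / 2 - 2) with hbdef
  have hM0 : 0 ≤ (N + 1) * (4 * (M * M')) := by
    have h1 := (abs_nonneg _).trans (hM.zeroth 0)
    have h2 := (abs_nonneg _).trans (hM'.zeroth 0)
    positivity
  have hbL : MemLp b 2 := by
    refine memLp_two_of_norm_le_rpow hN0 (C := (N + 1) * (4 * (M * M'))) (R := 3) hs ?_ ?_ ?_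
    · exact (((measurable_norm.pow_const _).const_mul _).indicator
        Metric.isOpen_ball.measurableSet).aestronglyMeasurable
    · intro x _
      rw [hbdef, Set.indicator_apply]
      split_ifs
      · rw [Real.norm_of_nonneg (by positivity)]
      · rw [norm_zero]
        positivity
    · intro x hx
      exact Set.indicator_of_notMem (by simpa using hx) _
  have hdom : ∀ {F : Type} [NormedAddCommGroup F] (k : ℕ) (f : RN N → F),
      (∀ x ≠ 0, ‖f x‖ ≤ (N + 1) * (4 * (M * M')) * ‖x‖ ^ (-γ / 2 - 2)) →
      (∀ x, ψ k =ᶠ[𝓝 x] 0 → f x = 0) → ∀ᵐ x, ‖f x‖ ≤ b x := by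
    intro F _ k f h1 h2
    filter_upwards [PuncturedSmooth.ae_ne_zero hN0] with x hx
    rw [hbdef, Set.indicator_apply]
    split_ifs with hx3
    · exact h1 x hx
    · rw [mem_ball_zero_iff, not_lt] at hx3
      rw [h2 x (hψ0 k x (by nlinarith [(Nat.cast_nonneg k : (0 : ℝ) ≤ k)])), norm_zero]
  have hpt : ∀ {F : Type} [NormedAddCommGroup F] (f : ℕ → RN N → F),
      (∀ k x, ψ k =ᶠ[𝓝 x] 0 → f k x = 0) → ∀ᵐ x, Tendsto (fun k => f k x) atTop (𝓝 0) := by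
    intro F _ f h
    filter_upwards [PuncturedSmooth.ae_ne_zero hN0] with x hx
    have hpos : 0 < ‖x‖ := norm_pos_iff.2 hx
    refine tendsto_const_nhds.congr' ?_
    filter_upwards [eventually_ge_atTop ⌈2 / ‖x‖⌉₊] with k hk
    refine (h k x (hψ0 k x ?_)).symm
    rw [← div_lt_iff₀ hpos]
    exact (Nat.ceil_le.1 hk).trans_lt (lt_add_one _)
  have hlim : Tendsto Q atTop (𝓝 0) := by
    have e1 : -γ / 2 = -γ / 2 - 2 + 2 := by ring
    have e2 : -γ / 2 - 1 = -γ / 2 - 2 + 1 := by ring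
    refine Prod.tendsto_iff _ _ |>.2 ⟨?_, Prod.tendsto_iff _ _ |>.2 ⟨?_, ?_⟩⟩
    · have hz : ∀ k x, ψ k =ᶠ[𝓝 x] 0 → ‖x‖ ^ (-γ / 2) • Laplacian.laplacian (ψ k) x = 0 :=
        fun k x h => by rw [eventuallyEq_zero_laplacian h, smul_zero]
      refine Lp.tendsto_zero_of_dominated (fun k => (hQ k).laplacian) hbL
        (fun k => hdom k _ (fun x hx => ?_) (hz k)) (hpt _ hz)
      have := (hb k).norm_weighted_laplacian_le (hψt k) (-γ / 2 - 2) hx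
      rwa [← e1] at this
    · have hz : ∀ k x, ψ k =ᶠ[𝓝 x] 0 → ‖x‖ ^ (-γ / 2 - 1) • gradient (ψ k) x = 0 :=
        fun k x h => by rw [eventuallyEq_zero_gradient h, smul_zero]
      refine Lp.tendsto_zero_of_dominated (fun k => (hQ k).gradient) hbL
        (fun k => hdom k _ (fun x hx => ?_) (hz k)) (hpt _ hz)
      have := (hb k).norm_weighted_gradient_le (-γ / 2 - 2) hx
      rwa [← e2] at this
    · have hz : ∀ k x, ψ k =ᶠ[𝓝 x] 0 → ‖x‖ ^ (-γ / 2 - 2) • ψ k x = 0 :=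
        fun k x h => by rw [h.eq_of_nhds, Pi.zero_apply, smul_zero]
      exact Lp.tendsto_zero_of_dominated (fun k => (hQ k).function) hbL
        (fun k => hdom k _ (fun x _ => (hb k).norm_weighted_function_le _ x) (hz k)) (hpt _ hz)
  have hlim' : Tendsto (fun k => p - Q k) atTop (𝓝 p) := by
    simpa using tendsto_const_nhds.sub hlim
  refine mem_closure_of_tendsto hlim' (Eventually.of_forall fun k => ?_)
  refine ⟨fun x => φ x - ψ k x, ⟨hφ.sub (hψt k), ?_⟩, hφ.represents_sub (hψt k) hp (hQ k)⟩
  rw [notMem_tsupport_iff_eventuallyEq]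
  filter_upwards [Metric.ball_mem_nhds (0 : RN N) (inv_pos.2 (hc k))] with y hy
  have : β (((k : ℝ) + 1) • y) = 1 := β.one_of_mem_closedBall (by
    rw [mem_closedBall_zero_iff, norm_smul, Real.norm_of_nonneg (hc k).le]
    rw [mem_ball_zero_iff] at hy
    have h1 := mul_le_mul_of_nonneg_left hy.le (hc k).le
    rwa [mul_inv_cancel₀ (hc k).ne'] at h1)
  simp [hψ, this]

/-! ### Weak derivatives of the elements of the completion -/

lemma measurable_norm_rpow (s : ℝ) : Measurable fun x : RN N => ‖x‖ ^ s :=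
  measurable_norm.pow_const s

lemma memLp_two_norm_rpow_smul {F : Type*} [NormedAddCommGroup F] [InnerProductSpace ℝ F]
    (hN : N ≠ 0) {s : ℝ} (hs : -(N : ℝ) < 2 * s) {k : RN N → F} (hk : Continuous k)
    (hc : HasCompactSupport k) : MemLp (fun x => ‖x‖ ^ s • k x) 2 := by
  obtain ⟨C, hC⟩ := hk.bounded_above_of_compact_support hc
  obtain ⟨R, hR⟩ := hc.isCompact.isBounded.exists_norm_le
  refine memLp_two_of_norm_le_rpow hN (C := C) (R := R + 1) hs
    ((measurable_norm_rpow s).aestronglyMeasurable.smul hk.aestronglyMeasurable)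
    (fun x _ => ?_) fun x hx => ?_
  · rw [norm_smul, Real.norm_of_nonneg (by positivity), mul_comm]
    exact mul_le_mul_of_nonneg_right (hC x) (by positivity)
  · have h0 : k x = 0 := image_eq_zero_of_notMem_tsupport fun h => by linarith [hR x h]
    rw [h0, smul_zero]

lemma locallyIntegrable_norm_rpow_smul {F : Type*} [NormedAddCommGroup F] [InnerProductSpace ℝ F]
    (hN : N ≠ 0) {s : ℝ} (hs : -(N : ℝ) < 2 * s) (f : Lp F 2 (volume : Measure (RN N))) :
    LocallyIntegrable fun x => ‖x‖ ^ s • f x := by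
  rw [locallyIntegrable_iff]
  intro K hK
  obtain ⟨R, hR⟩ := hK.isBounded.exists_norm_le
  set B : Set (RN N) := Metric.ball 0 (R + 1)
  have hB : MeasurableSet B := Metric.isOpen_ball.measurableSet
  have hw : MemLp (B.indicator fun x : RN N => ‖x‖ ^ s) 2 := by
    refine memLp_two_of_norm_le_rpow hN (C := 1) (R := R + 1) hs
      ((measurable_norm_rpow s).indicator hB).aestronglyMeasurable (fun x _ => ?_) fun x hx => ?_
    · rw [one_mul]
      refine (norm_indicator_le_norm_self _ _).trans ?_
      rw [Real.norm_of_nonneg (by positivity)]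
    · exact Set.indicator_of_notMem (by simpa [B] using hx) _
  have h : Integrable (fun x => B.indicator (fun x : RN N => ‖x‖ ^ s) x • f x) :=
    memLp_one_iff_integrable.1 ((Lp.memLp f).smul hw)
  have h' : IntegrableOn (fun x => ‖x‖ ^ s • f x) B :=
    h.integrableOn.congr_fun (fun x hx => by simp only [Set.indicator_of_mem hx]) hB
  exact h'.mono_set fun x hx => mem_ball_zero_iff.2 ((hR x hx).trans_lt (lt_add_one R))

/-- Weighted pairings of `L²` functions with continuous compactly supported functions are `L²` inner
products, hence continuous. -/
lemma inner_toLp_eq_integral {F : Type*} [NormedAddCommGroup F] [InnerProductSpace ℝ F]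
    (hN : N ≠ 0) {s : ℝ} {f : Lp F 2 (volume : Measure (RN N))} {g k : RN N → F}
    (hf : f =ᵐ[volume] fun x => ‖x‖ ^ s • g x) (hk : MemLp (fun x => ‖x‖ ^ (-s) • k x) 2) :
    inner ℝ (hk.toLp _) f = ∫ x, inner ℝ (k x) (g x) := by
  rw [Lp.inner_eq_integral hk.coeFn_toLp hf]
  refine integral_congr_ae ?_
  filter_upwards [PuncturedSmooth.ae_ne_zero hN] with x hx
  have hpos : 0 < ‖x‖ := norm_pos_iff.2 hx
  rw [real_inner_smul_left, real_inner_smul_right, ← mul_assoc, ← Real.rpow_add hpos,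
    neg_add_cancel, Real.rpow_zero, one_mul]

lemma ae_eq_norm_rpow_neg_smul {F : Type*} [NormedAddCommGroup F] [InnerProductSpace ℝ F]
    (hN : N ≠ 0) {s : ℝ} {f g : RN N → F} (hf : f =ᵐ[volume] fun x => ‖x‖ ^ s • g x) :
    g =ᵐ[volume] fun x => ‖x‖ ^ (-s) • f x := by
  filter_upwards [hf, PuncturedSmooth.ae_ne_zero hN] with x h hx
  have hpos : 0 < ‖x‖ := norm_pos_iff.2 hx
  rw [h, smul_smul, ← Real.rpow_add hpos, neg_add_cancel, Real.rpow_zero, one_smul]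

namespace IsTestFun

variable {φ ψ : RN N → ℝ}

lemma continuous_fderiv_apply (hφ : IsTestFun φ) (v : RN N) :
    Continuous fun x => fderiv ℝ φ x v :=
  (hφ.1.continuous_fderiv (by simp)).clm_apply continuous_const

lemma integral_mul_fderiv (hφ : IsTestFun φ) (hψ : IsTestFun ψ) (v : RN N) :
    ∫ x, φ x * fderiv ℝ ψ x v = -∫ x, fderiv ℝ φ x v * ψ x :=
  integral_mul_fderiv_eq_neg_fderiv_mul_of_integrable
    (((hφ.continuous_fderiv_apply v).mul hψ.1.continuous).integrable_of_hasCompactSupport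
      hψ.2.mul_left)
    ((hφ.1.continuous.mul (hψ.continuous_fderiv_apply v)).integrable_of_hasCompactSupport
      hφ.2.mul_right)
    (hφ.mul hψ).integrable (fun x _ => hφ.differentiableAt x) (fun x _ => hψ.differentiableAt x)

lemma integral_mul_laplacian (hφ : IsTestFun φ) (hψ : IsTestFun ψ) :
    ∫ x, φ x * Laplacian.laplacian ψ x = ∫ x, Laplacian.laplacian φ x * ψ x := by
  rw [hφ.laplacian_eq, hψ.laplacian_eq]
  simp only [Finset.mul_sum, Finset.sum_mul]
  rw [integral_finsetSum _ fun i _ => (hφ.mul ((hψ.partialDeriv i).partialDeriv i)).integrable,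
    integral_finsetSum _ fun i _ => (((hφ.partialDeriv i).partialDeriv i).mul hψ).integrable]
  refine Finset.sum_congr rfl fun i _ => ?_
  have h1 := hφ.integral_mul_fderiv (hψ.partialDeriv i) (basisVec i)
  have h2 := (hφ.partialDeriv i).integral_mul_fderiv hψ (basisVec i)
  exact h1.trans (neg_eq_iff_eq_neg.2 h2)

lemma hasCompactSupport_laplacian (hφ : IsTestFun φ) :
    HasCompactSupport (Laplacian.laplacian φ) := by
  obtain ⟨R, hR⟩ := hφ.exists_eq_zero_of_le_norm
  refine HasCompactSupport.intro (isCompact_closedBall (0 : RN N) R) fun x hx => ?_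
  rw [mem_closedBall_zero_iff, not_le] at hx
  exact eventuallyEq_zero_laplacian (hR x hx.le)

end IsTestFun

lemma inner_gradient (φ : RN N → ℝ) (x v : RN N) : inner ℝ (gradient φ x) v = fderiv ℝ φ x v := by
  rw [gradient, InnerProductSpace.toDual_symm_apply]

namespace Represents

variable {γ : ℝ} {p : EnergySpace N} {u L : RN N → ℝ} {G : RN N → RN N}

lemma exists_functions (hN : N ≠ 0) (γ : ℝ) (p : EnergySpace N) :
    ∃ u G L, Represents γ p u G L := by
  refine ⟨fun x => ‖x‖ ^ (-(-γ / 2 - 2)) • p.2.2 x, fun x => ‖x‖ ^ (-(-γ / 2 - 1)) • p.2.1 x,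
    fun x => ‖x‖ ^ (-(-γ / 2)) • p.1 x, ?_, ?_, ?_⟩ <;>
  · filter_upwards [PuncturedSmooth.ae_ne_zero hN] with x hx
    have hpos : 0 < ‖x‖ := norm_pos_iff.2 hx
    rw [smul_smul, ← Real.rpow_add hpos, add_neg_cancel, Real.rpow_zero, one_smul]

lemma locallyIntegrable_function (hN : 5 ≤ N) (hγ : -2 < γ) (h : Represents γ p u G L) :
    LocallyIntegrable u := by
  have hN' : (5 : ℝ) ≤ N := by exact_mod_cast hN
  exact (locallyIntegrable_norm_rpow_smul (by omega) (by linarith) p.2.2).congr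
    (ae_eq_norm_rpow_neg_smul (by omega) h.function).symm

lemma locallyIntegrable_gradient (hN : 5 ≤ N) (hγ : -2 < γ) (h : Represents γ p u G L) :
    LocallyIntegrable G := by
  have hN' : (5 : ℝ) ≤ N := by exact_mod_cast hN
  exact (locallyIntegrable_norm_rpow_smul (by omega) (by linarith) p.2.1).congr
    (ae_eq_norm_rpow_neg_smul (by omega) h.gradient).symm

lemma locallyIntegrable_laplacian (hN : 5 ≤ N) (hγ : -2 < γ) (h : Represents γ p u G L) :
    LocallyIntegrable L := by
  have hN' : (5 : ℝ) ≤ N := by exact_mod_cast hN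
  exact (locallyIntegrable_norm_rpow_smul (by omega) (by linarith) p.1).congr
    (ae_eq_norm_rpow_neg_smul (by omega) h.laplacian).symm

lemma hasWeakGradient (hN : 5 ≤ N) (hγ : -2 < γ) (hp : p ∈ energyClosure N γ)
    (h : Represents γ p u G L) : HasWeakGradient u G := by
  have hN0 : N ≠ 0 := by omega
  have hN' : (5 : ℝ) ≤ N := by exact_mod_cast hN
  refine ⟨h.locallyIntegrable_function hN hγ, h.locallyIntegrable_gradient hN hγ, fun ψ hψ v => ?_⟩
  have hk₁ : MemLp (fun x => ‖x‖ ^ (-(-γ / 2 - 2)) • fderiv ℝ ψ x v) 2 :=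
    memLp_two_norm_rpow_smul hN0 (by linarith) (hψ.continuous_fderiv_apply v)
      (hψ.2.fderiv_apply ℝ v)
  have hk₂ : MemLp (fun x => ‖x‖ ^ (-(-γ / 2 - 1)) • (ψ x • v)) 2 :=
    memLp_two_norm_rpow_smul hN0 (by linarith) (hψ.1.continuous.smul continuous_const)
      hψ.2.smul_right
  have key : ∀ {q : EnergySpace N} {u' L' : RN N → ℝ} {G' : RN N → RN N},
      Represents γ q u' G' L' → (inner ℝ (hk₁.toLp _) q.2.2 + inner ℝ (hk₂.toLp _) q.2.1 = 0 ↔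
        ∫ x, u' x * fderiv ℝ ψ x v = -∫ x, inner ℝ (G' x) v * ψ x) := by
    intro q u' L' G' hq
    rw [inner_toLp_eq_integral hN0 hq.function, inner_toLp_eq_integral hN0 hq.gradient,
      ← eq_neg_iff_add_eq_zero]
    simp only [real_inner_smul_left, real_inner_comm v, mul_comm (ψ _)]
    rfl
  refine (key h).1 (energyClosure.induction
    (C := {q | inner ℝ (hk₁.toLp _) q.2.2 + inner ℝ (hk₂.toLp _) q.2.1 = 0})
    (isClosed_eq (by fun_prop) continuous_const) (fun φ q hφ hr => (key hr).2 ?_) hp)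
  simp only [inner_gradient]
  exact hφ.1.integral_mul_fderiv hψ v

lemma hasWeakLaplacian (hN : 5 ≤ N) (hγ : -2 < γ) (hp : p ∈ energyClosure N γ)
    (h : Represents γ p u G L) : HasWeakLaplacian u L := by
  have hN0 : N ≠ 0 := by omega
  have hN' : (5 : ℝ) ≤ N := by exact_mod_cast hN
  refine ⟨h.locallyIntegrable_function hN hγ, h.locallyIntegrable_laplacian hN hγ, fun ψ hψ => ?_⟩
  have hk₁ : MemLp (fun x => ‖x‖ ^ (-(-γ / 2 - 2)) • Laplacian.laplacian ψ x) 2 :=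
    memLp_two_norm_rpow_smul hN0 (by linarith) hψ.continuous_laplacian
      hψ.hasCompactSupport_laplacian
  have hk₂ : MemLp (fun x => ‖x‖ ^ (-(-γ / 2)) • ψ x) 2 :=
    memLp_two_norm_rpow_smul hN0 (by linarith) hψ.1.continuous hψ.2
  have key : ∀ {q : EnergySpace N} {u' L' : RN N → ℝ} {G' : RN N → RN N},
      Represents γ q u' G' L' → (inner ℝ (hk₁.toLp _) q.2.2 = inner ℝ (hk₂.toLp _) q.1 ↔
        ∫ x, u' x * Laplacian.laplacian ψ x = ∫ x, L' x * ψ x) := by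
    intro q u' L' G' hq
    rw [inner_toLp_eq_integral hN0 hq.function, inner_toLp_eq_integral hN0 hq.laplacian]
    rfl
  exact (key h).1 (energyClosure.induction
    (C := {q | inner ℝ (hk₁.toLp _) q.2.2 = inner ℝ (hk₂.toLp _) q.1})
    (isClosed_eq (by fun_prop) (by fun_prop))
    (fun φ q hφ hr => (key hr).2 (hφ.1.integral_mul_laplacian hψ)) hp)

end Represents

/-- Uniqueness of the weak gradient. -/
lemma HasWeakGradient.ae_eq {u : RN N → ℝ} {G G' : RN N → RN N} (h : HasWeakGradient u G)
    (h' : HasWeakGradient u G') : G =ᵐ[volume] G' := by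
  have hint : ∀ {H : RN N → RN N} (v : RN N), LocallyIntegrable H →
      LocallyIntegrable fun x => (inner ℝ (H x) v : ℝ) := by
    intro H v hH x
    obtain ⟨s, hs, hi⟩ := hH x
    exact ⟨s, hs, hi.inner_const v⟩
  have hi : ∀ i, ∀ᵐ x, inner ℝ (G x) (basisVec i) = inner ℝ (G' x) (basisVec i) := by
    intro i
    refine ae_eq_of_integral_contDiff_smul_eq (hint _ h.2.1) (hint _ h'.2.1) fun ψ hψ hc => ?_
    have := neg_injective ((h.2.2 ψ ⟨hψ, hc⟩ (basisVec i)).symm.trans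
      (h'.2.2 ψ ⟨hψ, hc⟩ (basisVec i)))
    simpa only [smul_eq_mul, mul_comm] using this
  filter_upwards [ae_all_iff.2 hi] with x hx
  ext i
  simpa [basisVec, EuclideanSpace.inner_single_right] using hx i

/-- Uniqueness of the weak Laplacian. -/
lemma HasWeakLaplacian.ae_eq {u L L' : RN N → ℝ} (h : HasWeakLaplacian u L)
    (h' : HasWeakLaplacian u L') : L =ᵐ[volume] L' := by
  refine ae_eq_of_integral_contDiff_smul_eq h.2.1 h'.2.1 fun ψ hψ hc => ?_
  have := (h.2.2 ψ ⟨hψ, hc⟩).symm.trans (h'.2.2 ψ ⟨hψ, hc⟩)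
  simpa only [smul_eq_mul, mul_comm] using this

lemma tendsto_integral_mul_of_tendsto_lintegral {u ψ : RN N → ℝ} {φ : ℕ → RN N → ℝ}
    (hu : LocallyIntegrable u) (hφ : ∀ n, IsTestFun (φ n)) (hψ : IsTestFun ψ)
    (h : ∀ K : Set (RN N), IsCompact K →
      Tendsto (fun n => ∫⁻ x in K, ‖φ n x - u x‖ₑ) atTop (𝓝 0)) :
    Tendsto (fun n => ∫ x, ψ x * φ n x) atTop (𝓝 (∫ x, ψ x * u x)) := by
  obtain ⟨M, hM⟩ := hψ.1.continuous.bounded_above_of_compact_support hψ.2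
  have hui : Integrable fun x => ψ x * u x := by
    simpa using hu.integrable_smul_left_of_hasCompactSupport hψ.1.continuous hψ.2
  refine tendsto_integral_of_L1 _ hui.aestronglyMeasurable
    (Eventually.of_forall fun n => (hψ.mul (hφ n)).integrable) ?_
  have hlim := ENNReal.Tendsto.const_mul (a := ENNReal.ofReal M) (h _ hψ.2.isCompact)
    (Or.inr ENNReal.ofReal_ne_top)
  rw [mul_zero] at hlim
  refine tendsto_of_tendsto_of_tendsto_of_le_of_le tendsto_const_nhds hlim (fun n => zero_le)
    fun n => ?_
  rw [← lintegral_const_mul' _ _ ENNReal.ofReal_ne_top,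
    ← lintegral_indicator (isClosed_tsupport ψ).measurableSet]
  refine lintegral_mono fun x => ?_
  by_cases hx : x ∈ tsupport ψ
  · rw [Set.indicator_of_mem hx, ← mul_sub, enorm_mul]
    gcongr
    rw [← ofReal_norm]
    exact ENNReal.ofReal_le_ofReal (hM x)
  · simp [image_eq_zero_of_notMem_tsupport hx]

/-- Every element of the completion comes from the closure of the test functions. Its `L¹_loc` limit
agrees with the weighted `L²` limit since both have the same integrals against test functions. -/
lemma MemD22.exists_represents {γ : ℝ} (hN : 5 ≤ N) (hγ : -2 < γ) (hγ' : γ ≤ 0) {u : RN N → ℝ}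
    (hu : MemD22 γ u) : ∃ p ∈ energyClosure N γ, ∃ G L, Represents γ p u G L := by
  have hN0 : N ≠ 0 := by omega
  have hN' : (5 : ℝ) ≤ N := by exact_mod_cast hN
  obtain ⟨huL, φ, hφ, hcau, hlim⟩ := hu
  choose P hP using fun n => (hφ n).exists_represents (γ := γ) hN hγ'
  have hPm : ∀ n, P n ∈ energyClosure N γ := fun n => (hφ n).mem_energyClosure hN hγ' (hP n)
  have hd : ∀ m n, P m - P n ∈ energyClosure N γ := fun m n =>
    ((hφ m).sub (hφ n)).mem_energyClosure hN hγ' ((hφ m).represents_sub (hφ n) (hP m) (hP n))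
  have hnorm : ∀ m n, weightedLaplacianNorm γ (φ m - φ n) = ‖(P m - P n).1‖ := by
    intro m n
    have h := ((hφ m).represents_sub (hφ n) (hP m) (hP n)).rellichEnergy_eq hN0
    rw [weightedLaplacianNorm, ← Real.sqrt_sq (norm_nonneg (P m - P n).1), ← h]
    rfl
  -- the Laplacian component controls the two other components
  have hctrl : ∀ q ∈ energyClosure N γ, ‖q‖ ≤ 4 * ‖q.1‖ := by
    intro q hq
    have h1 := energyClosure.rellich_le hN hγ hγ' hq
    have h2 := energyClosure.hardy_le hN0 hq
    have h3 : ‖q.2.1‖ ≤ 2 * ‖q.1‖ :=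
      abs_le_of_sq_le_sq' (by nlinarith) (by positivity) |>.2
    have h4 : ‖q.2.2‖ ≤ 2 * ‖q.2.1‖ := by
      refine abs_le_of_sq_le_sq' ?_ (by positivity) |>.2
      have h5 : (1 / 2 : ℝ) ^ 2 ≤ (((N : ℝ) - 4 - γ) / 2) ^ 2 :=
        pow_le_pow_left₀ (by norm_num) (by linarith) 2
      nlinarith [mul_le_mul_of_nonneg_right h5 (sq_nonneg ‖q.2.2‖)]
    have h6 := norm_nonneg q.1
    exact max_le (by linarith) (max_le (by linarith) (by linarith))
  have hPc : CauchySeq P := by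
    refine Metric.cauchySeq_iff.2 fun ε hε => ?_
    obtain ⟨n₀, hn₀⟩ := hcau (ε / 4) (by positivity)
    refine ⟨n₀, fun m hm n hn => ?_⟩
    rw [dist_eq_norm]
    have h1 := hn₀ m hm n hn
    rw [hnorm] at h1
    linarith [hctrl _ (hd m n)]
  obtain ⟨p, hp⟩ := cauchySeq_tendsto_of_complete hPc
  have hpm : p ∈ energyClosure N γ := isClosed_closure.mem_of_tendsto hp (Eventually.of_forall hPm)
  obtain ⟨u', G, L, hr⟩ := Represents.exists_functions hN0 γ p
  refine ⟨p, hpm, G, L, hr.congr ?_ (EventuallyEq.refl _ _) (EventuallyEq.refl _ _)⟩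
  refine ae_eq_of_integral_contDiff_smul_eq huL (hr.locallyIntegrable_function hN hγ)
    fun ψ hψ hc => ?_
  have hk : MemLp (fun x => ‖x‖ ^ (-(-γ / 2 - 2)) • ψ x) 2 :=
    memLp_two_norm_rpow_smul hN0 (by linarith) hψ.continuous hc
  have hpair : ∀ {q : EnergySpace N} {w L' : RN N → ℝ} {G' : RN N → RN N},
      Represents γ q w G' L' → inner ℝ (hk.toLp _) q.2.2 = ∫ x, ψ x * w x := by
    intro q w L' G' hq
    rw [inner_toLp_eq_integral hN0 hq.function]
    simp only [mul_comm (ψ _)]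
    rfl
  have h1 := tendsto_integral_mul_of_tendsto_lintegral huL hφ ⟨hψ, hc⟩ hlim
  have hcont : Continuous fun q : EnergySpace N => inner ℝ (hk.toLp _) q.2.2 := by fun_prop
  have h2 := (hcont.tendsto p).comp hp
  rw [hpair hr] at h2
  refine tendsto_nhds_unique (h1.congr fun n => ?_) h2
  exact (hpair (hP n)).symm

/-! ### Sharpness: slowly varying radial functions -/

namespace PuncturedSmooth

/-- The radial function `x ↦ g (log |x|)`. -/
def logRadial (g : ℝ → ℝ) (hg : ContDiff ℝ ∞ g) : PuncturedSmooth N :=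
  ofFun (fun x => g (Real.log ‖x‖)) fun _ hx =>
    hg.contDiffAt.comp _ ((contDiffAt_norm ℝ hx).log (norm_ne_zero_iff.2 hx))

lemma ext_logRadial {g : ℝ → ℝ} (hg : ContDiff ℝ ∞ g) {x : RN N} (hx : x ≠ 0) :
    (logRadial g hg).ext x = g (Real.log ‖x‖) := ext_ofFun _ hx

lemma contDiff_deriv {g : ℝ → ℝ} (hg : ContDiff ℝ ∞ g) : ContDiff ℝ ∞ (deriv g) :=
  (contDiff_infty_iff_deriv.1 hg).2

lemma scaledDeriv_logRadial {g : ℝ → ℝ} (hg : ContDiff ℝ ∞ g) (i : Fin N) :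
    scaledDeriv i (logRadial g hg) = dir i * logRadial (deriv g) (contDiff_deriv hg) := by
  refine ext_injective fun x hx => ?_
  have hpos : 0 < ‖x‖ := norm_pos_iff.2 hx
  rw [ext_scaledDeriv_apply, ext_mul, ext_dir _ hx, ext_logRadial _ hx, logRadial,
    (ext_ofFun_eventuallyEq _ hx).partialDeriv_eq]
  have hn := partialDeriv_norm_rpow 1 hx i
  simp only [Real.rpow_one, partialDeriv] at hn
  have hnd : HasFDerivAt (fun y : RN N => ‖y‖) (fderiv ℝ (fun y : RN N => ‖y‖) x) x :=
    ((contDiffAt_norm (n := ∞) ℝ hx).differentiableAt (by simp)).hasFDerivAt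
  have hd := ((hg.differentiable (by simp)).differentiableAt.hasDerivAt.comp_hasFDerivAt x
    (hnd.log hpos.ne') : HasFDerivAt (fun y : RN N => g (Real.log ‖y‖)) _ x)
  rw [partialDeriv, show fderiv ℝ (fun y : RN N => g (Real.log ‖y‖)) x = _ from hd.fderiv]
  simp only [smul_apply, hn, smul_eq_mul]
  rw [show (1 - 2 : ℝ) = -1 by norm_num, Real.rpow_neg_one]
  field_simp

/-- `y ↦ y^{-N}` restricted to `|log y| ≤ T`, the radial profile of the density `|x|^{-N}` on an
annulus. -/
def logIndicator (N : ℕ) (T : ℝ) : ℝ → ℝ :=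
  (Set.Icc (Real.exp (-T)) (Real.exp T)).indicator fun z => z ^ (-N : ℝ)

lemma pow_mul_logIndicator (hN : N ≠ 0) (T y : ℝ) :
    y ^ (N - 1) • logIndicator N T y =
      (Set.Icc (Real.exp (-T)) (Real.exp T)).indicator (fun z => z⁻¹) y := by
  rw [logIndicator]
  by_cases hy : y ∈ Set.Icc (Real.exp (-T)) (Real.exp T)
  · have hpos : 0 < y := (Real.exp_pos _).trans_le hy.1
    rw [Set.indicator_of_mem hy, Set.indicator_of_mem hy, smul_eq_mul, ← Real.rpow_natCast,
      ← Real.rpow_add hpos, ← Real.rpow_neg_one, Nat.cast_sub (Nat.one_le_iff_ne_zero.2 hN)]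
    congr 1
    push_cast
    ring
  · rw [Set.indicator_of_notMem hy, Set.indicator_of_notMem hy, smul_zero]

lemma integrableOn_inv_Icc_exp (T : ℝ) :
    IntegrableOn (fun y : ℝ => y⁻¹) (Set.Icc (Real.exp (-T)) (Real.exp T)) :=
  (continuousOn_id.inv₀ fun _ hy =>
    ((Real.exp_pos _).trans_le hy.1).ne').integrableOn_compact isCompact_Icc

lemma integrable_logIndicator (hN : N ≠ 0) (T : ℝ) :
    Integrable fun x : RN N => logIndicator N T ‖x‖ := by
  have : Nontrivial (RN N) := ⟨⟨basisVec ⟨0, Nat.pos_of_ne_zero hN⟩, 0, by simp [basisVec]⟩⟩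
  rw [integrable_fun_norm_addHaar volume (f := logIndicator N T)]
  simp only [finrank_euclideanSpace_fin, pow_mul_logIndicator hN]
  exact ((integrable_indicator_iff measurableSet_Icc).2 (integrableOn_inv_Icc_exp T)).integrableOn

lemma integral_logIndicator (hN : N ≠ 0) {T : ℝ} (hT : 0 ≤ T) :
    ∫ x : RN N, logIndicator N T ‖x‖ =
      N * (volume : Measure (RN N)).real (Metric.ball 0 1) * (2 * T) := by
  have : Nontrivial (RN N) := ⟨⟨basisVec ⟨0, Nat.pos_of_ne_zero hN⟩, 0, by simp [basisVec]⟩⟩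
  rw [integral_fun_norm_addHaar volume (logIndicator N T)]
  simp only [finrank_euclideanSpace_fin, pow_mul_logIndicator hN]
  have hsub : Set.Icc (Real.exp (-T)) (Real.exp T) ⊆ Set.Ioi 0 := fun y hy =>
    (Real.exp_pos _).trans_le hy.1
  have hle : Real.exp (-T) ≤ Real.exp T := Real.exp_le_exp.2 (by linarith)
  rw [setIntegral_indicator measurableSet_Icc, Set.inter_eq_self_of_subset_right hsub,
    integral_Icc_eq_integral_Ioc, ← intervalIntegral.integral_of_le hle,
    integral_inv_of_pos (Real.exp_pos _) (Real.exp_pos _), ← Real.exp_sub, Real.log_exp]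
  simp only [nsmul_eq_mul, smul_eq_mul]
  ring

lemma logRadial_mem_annular {g : ℝ → ℝ} (hg : ContDiff ℝ ∞ g) {T : ℝ}
    (hT : ∀ t, T < |t| → g t = 0) : (logRadial g hg : PuncturedSmooth N) ∈ annular N := by
  refine ⟨Real.exp (-T), Real.exp_pos _, Real.exp T, fun x hx => ?_⟩
  have hx0 : x ≠ 0 := fun h => hx (by rw [h, ext_apply_zero])
  have hpos : 0 < ‖x‖ := norm_pos_iff.2 hx0
  rw [ext_logRadial _ hx0] at hx
  have h := abs_le.1 (not_lt.1 fun h => hx (hT _ h))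
  rw [← Real.le_log_iff_exp_le hpos, ← Real.log_le_iff_le_exp hpos]
  exact h

lemma mem_Icc_exp_iff {x : RN N} (hx : x ≠ 0) (T : ℝ) :
    ‖x‖ ∈ Set.Icc (Real.exp (-T)) (Real.exp T) ↔ |Real.log ‖x‖| ≤ T := by
  have hpos : 0 < ‖x‖ := norm_pos_iff.2 hx
  rw [Set.mem_Icc, ← Real.le_log_iff_exp_le hpos, ← Real.log_le_iff_le_exp hpos, abs_le]

lemma le_invariantIntegral_logRadial_sq (hN : N ≠ 0) {g : ℝ → ℝ} (hg : ContDiff ℝ ∞ g) {S T : ℝ}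
    (hT : 0 ≤ T) (hS : ∀ t, S < |t| → g t = 0) (h : ∀ t, |t| ≤ T → 1 ≤ g t) :
    N * (volume : Measure (RN N)).real (Metric.ball 0 1) * (2 * T) ≤
      (polarCalculus N).I (logRadial g hg * logRadial g hg) := by
  have hmem := (annular N).mul_mem_left (logRadial g hg) (logRadial_mem_annular hg hS)
  rw [← integral_logIndicator hN hT]
  change _ ≤ invariantIntegral N _
  rw [invariantIntegral_eq hmem]
  refine integral_mono_ae (integrable_logIndicator hN T) (integrable_mul_norm_rpow hmem _) ?_
  filter_upwards [ae_ne_zero hN] with x hx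
  rw [ext_mul, ext_logRadial _ hx, logIndicator]
  by_cases hy : ‖x‖ ∈ Set.Icc (Real.exp (-T)) (Real.exp T)
  · rw [Set.indicator_of_mem hy]
    have h1 := h _ ((mem_Icc_exp_iff hx T).1 hy)
    exact le_mul_of_one_le_left (by positivity) (by nlinarith)
  · rw [Set.indicator_of_notMem hy]
    exact mul_nonneg (mul_self_nonneg _) (by positivity)

lemma invariantIntegral_logRadial_sq_le (hN : N ≠ 0) {g : ℝ → ℝ} (hg : ContDiff ℝ ∞ g) {T M : ℝ}
    (hT : 0 ≤ T) (hS : ∀ t, T < |t| → g t = 0) (h : ∀ t, |g t| ≤ M) :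
    (polarCalculus N).I (logRadial g hg * logRadial g hg) ≤
      M ^ 2 * (N * (volume : Measure (RN N)).real (Metric.ball 0 1) * (2 * T)) := by
  have hmem := (annular N).mul_mem_left (logRadial g hg) (logRadial_mem_annular hg hS)
  rw [← integral_logIndicator hN hT, ← integral_const_mul]
  change invariantIntegral N _ ≤ _
  rw [invariantIntegral_eq hmem]
  refine integral_mono_ae (integrable_mul_norm_rpow hmem _)
    ((integrable_logIndicator hN T).const_mul _) ?_
  filter_upwards [ae_ne_zero hN] with x hx
  rw [ext_mul, ext_logRadial _ hx, logIndicator]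
  by_cases hy : ‖x‖ ∈ Set.Icc (Real.exp (-T)) (Real.exp T)
  · rw [Set.indicator_of_mem hy]
    refine mul_le_mul_of_nonneg_right ?_ (by positivity)
    rw [← sq]
    exact sq_le_sq' (abs_le.1 (h _)).1 (abs_le.1 (h _)).2
  · rw [Set.indicator_of_notMem hy, hS _ (not_le.1 fun h => hy ((mem_Icc_exp_iff hx T).2 h))]
    simp

/-- Nearly optimal functions `|x|^{-a} g(log |x|)`, where `g(t) = θ(t / T)` is a bump function of
width `T`: they have no tangential derivatives, and the deficit `‖g''‖²` is of order `T⁻³`, while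
the gradient energy is at least of order `T`. -/
lemma exists_nearly_optimal (hN : 5 ≤ N) {γ : ℝ} (hγ' : γ ≤ 0) {ε : ℝ} (hε : 0 < ε) :
    ∃ φ : RN N → ℝ, IsPuncturedTestFun φ ∧ φ ≠ 0 ∧
      hardyRellichSum γ φ (Laplacian.laplacian φ) ≤
        (hardyRellichConst N γ + ε) * gradientEnergy γ (gradient φ) := by
  have hN0 : N ≠ 0 := by omega
  have hN' : (5 : ℝ) ≤ N := by exact_mod_cast hN
  let θ : ContDiffBump (0 : ℝ) := ⟨1, 2, one_pos, one_lt_two⟩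
  have hθ : ContDiff ℝ ∞ θ := θ.contDiff
  have hθ' := contDiff_deriv hθ
  have hθ'' := contDiff_deriv hθ'
  obtain ⟨M, hM⟩ := hθ''.continuous.bounded_above_of_compact_support
    θ.hasCompactSupport.deriv.deriv
  set a : ℝ := (N - 4 - γ) / 2 with ha
  have ha0 : 1 / 2 ≤ a := by rw [ha]; linarith
  -- the width for which the deficit is at most `ε` times the gradient energy
  set T : ℝ := 1 + 8 * M ^ 2 / ε with hT
  have hT1 : 1 ≤ T := by
    rw [hT]
    have : 0 ≤ 8 * M ^ 2 / ε := by positivity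
    linarith
  have hT0 : 0 < T := by linarith
  have hMT : 8 * M ^ 2 ≤ ε * T := by
    rw [hT, mul_add, mul_div_cancel₀ _ hε.ne']
    linarith
  have hder : ∀ f : ℝ → ℝ, deriv (fun t => f (T⁻¹ * t)) = fun t => T⁻¹ * deriv f (T⁻¹ * t) :=
    fun f => funext fun t => by simpa using deriv_comp_mul_left T⁻¹ f t
  set g : ℝ → ℝ := fun t => θ (T⁻¹ * t) with hgdef
  have hg : ContDiff ℝ ∞ g := hθ.comp (contDiff_const.mul contDiff_id)
  have hg'' : deriv (deriv g) = fun t => T⁻¹ * (T⁻¹ * deriv (deriv θ) (T⁻¹ * t)) := by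
    rw [hgdef, hder]
    funext t
    rw [deriv_const_mul_field, hder]
  have hTabs : ∀ t, 2 * T < |t| → 2 < |T⁻¹ * t| := fun t ht => by
    rw [abs_mul, abs_of_pos (inv_pos.2 hT0), inv_mul_eq_div, lt_div_iff₀ hT0]
    exact ht
  have hzero : ∀ t, 2 < |t| → θ =ᶠ[𝓝 t] fun _ => (0 : ℝ) := fun t ht => by
    filter_upwards [(isOpen_lt continuous_const continuous_abs).mem_nhds ht] with s hs
    exact θ.zero_of_le_dist (by simpa using le_of_lt hs)
  have hgz : ∀ t, 2 * T < |t| → g t = 0 := fun t ht => (hzero _ (hTabs t ht)).eq_of_nhds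
  have hgz'' : ∀ t, 2 * T < |t| → deriv (deriv g) t = 0 := fun t ht => by
    rw [hg'']
    simp [(hzero _ (hTabs t ht)).deriv.deriv_eq]
  have hgone : ∀ t, |t| ≤ T → 1 ≤ g t := fun t ht => by
    refine (θ.one_of_mem_closedBall ?_).ge
    rw [mem_closedBall_zero_iff, Real.norm_eq_abs, abs_mul, abs_of_pos (inv_pos.2 hT0),
      inv_mul_eq_div]
    exact (div_le_one hT0).2 ht
  have hgM : ∀ t, |deriv (deriv g) t| ≤ T⁻¹ * (T⁻¹ * M) := fun t => by
    rw [hg'', abs_mul, abs_mul, abs_of_pos (inv_pos.2 hT0)]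
    have := hM (T⁻¹ * t)
    rw [Real.norm_eq_abs] at this
    gcongr
  set P := polarCalculus N
  set v : PuncturedSmooth N := logRadial g hg with hv
  have hvm : v ∈ annular N := logRadial_mem_annular hg hgz
  have hv' : v ∈ P.S := hvm
  have hE : P.E v = logRadial (deriv g) (contDiff_deriv hg) :=
    P.E_eq_of_radial fun i => scaledDeriv_logRadial hg i
  have hEE : P.E (P.E v) = logRadial (deriv (deriv g)) (contDiff_deriv (contDiff_deriv hg)) := by
    rw [hE]
    exact P.E_eq_of_radial fun i => scaledDeriv_logRadial _ i
  have hD : ∀ i, P.D i v = 0 := P.D_eq_zero_of_radial fun i => scaledDeriv_logRadial hg i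
  have hDE : ∀ i, P.D i (P.E v) = 0 := fun i => by
    rw [← P.E_D_comm, hD, map_zero]
  have hΛ : P.Λ v = 0 := by simp [PolarCalculus.Λ, hD]
  set κ : ℝ := N * (volume : Measure (RN N)).real (Metric.ball 0 1) with hκ
  have hκ0 : 0 < κ := by
    have : 0 < (volume : Measure (RN N)).real (Metric.ball 0 1) :=
      ENNReal.toReal_pos (Metric.measure_ball_pos _ _ one_pos).ne' measure_ball_lt_top.ne
    positivity
  have hlow : κ * (2 * T) ≤ P.I (v * v) :=
    le_invariantIntegral_logRadial_sq hN0 hg hT0.le hgz hgone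
  have hupp : P.I (P.E (P.E v) * P.E (P.E v)) ≤ (T⁻¹ * (T⁻¹ * M)) ^ 2 * (κ * (2 * (2 * T))) := by
    rw [hEE]
    exact invariantIntegral_logRadial_sq_le hN0 _ (by positivity) hgz'' hgM
  have hid := hardyRellich_identity (γ := γ) (a := a) hN0 (by rw [ha]; ring) hvm
  have hgrad := gradientEnergy_eq (γ := γ) (a := a) hN0 (by rw [ha]; ring) hvm
  have hEpos := P.I_mul_self_nonneg _ (P.E_mem hv')
  simp only [show ∀ i, (polarCalculus N).D i v = 0 from hD,
    show ∀ i, (polarCalculus N).D i ((polarCalculus N).E v) = 0 from hDE,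
    show (polarCalculus N).Λ v = 0 from hΛ, mul_zero, map_zero, Finset.sum_const_zero, add_zero,
    sub_zero] at hid hgrad
  have hbound : P.I (P.E (P.E v) * P.E (P.E v)) ≤ ε * (a ^ 2 * P.I (v * v)) := by
    have h1 : (T⁻¹ * (T⁻¹ * M)) ^ 2 * (κ * (2 * (2 * T))) = (8 * M ^ 2) * (κ * T⁻¹ ^ 3 / 2) := by
      field_simp
      ring
    have h2 : (8 * M ^ 2) * (κ * T⁻¹ ^ 3 / 2) ≤ (ε * T) * (κ * T⁻¹ ^ 3 / 2) :=
      mul_le_mul_of_nonneg_right hMT (by positivity)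
    have h3 : (ε * T) * (κ * T⁻¹ ^ 3 / 2) = ε * κ * T⁻¹ ^ 2 / 2 := by
      field_simp
    have h4 : ε * κ * T⁻¹ ^ 2 / 2 ≤ ε * κ * T / 2 := by
      have : T⁻¹ ^ 2 ≤ T := (pow_le_one₀ (by positivity) (inv_le_one_of_one_le₀ hT1)).trans hT1
      gcongr
    have h5 : ε * κ * T / 2 ≤ ε * (a ^ 2 * P.I (v * v)) := by
      have h6 : (1 / 4) * (κ * (2 * T)) ≤ a ^ 2 * P.I (v * v) :=
        mul_le_mul (by nlinarith) hlow (by positivity) (by positivity)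
      nlinarith
    linarith
  refine ⟨(normRpow (-a) * v).ext,
    isPuncturedTestFun_ext ((annular N).mul_mem_left _ hvm), fun h0 => ?_, ?_⟩
  · have hH := hardyEnergy_eq (γ := γ) (a := a) hN0 (by rw [ha]; ring) hvm
    rw [h0] at hH
    have : 0 < κ * (2 * T) := by positivity
    simp only [hardyEnergy, Pi.zero_apply, ne_eq, OfNat.ofNat_ne_zero, not_false_eq_true, zero_pow,
      mul_zero, integral_zero] at hH
    exact absurd hH (this.trans_le hlow).ne
  · change _ = P.I _ + a ^ 2 * P.I _ at hgrad
    change _ = P.I _ at hid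
    rw [add_mul]
    nlinarith

end PuncturedSmooth

/-! ### The inequality in the completion -/

namespace Represents

variable {γ : ℝ} {p : EnergySpace N} {u L : RN N → ℝ} {G : RN N → RN N}

lemma hardyRellich_le (hN : 5 ≤ N) (hγ : -2 < γ) (hγ' : γ ≤ 0) (hp : p ∈ energyClosure N γ)
    (h : Represents γ p u G L) :
    hardyRellichConst N γ * gradientEnergy γ G ≤ hardyRellichSum γ u L := by
  have hN0 : N ≠ 0 := by omega
  rw [hardyRellichSum, h.gradientEnergy_eq hN0, h.rellichEnergy_eq hN0, h.hardyEnergy_eq hN0]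
  exact energyClosure.hardyRellich_le hN hγ hγ' hp

lemma hardyRellich_lt (hN : 5 ≤ N) (hγ : -2 < γ) (hγ' : γ ≤ 0) (hp : p ∈ energyClosure N γ)
    (h : Represents γ p u G L) (hu : ¬ u =ᵐ[volume] 0) :
    hardyRellichConst N γ * gradientEnergy γ G < hardyRellichSum γ u L := by
  have hN0 : N ≠ 0 := by omega
  refine (h.hardyRellich_le hN hγ hγ' hp).lt_of_ne fun heq => hu ?_
  rw [hardyRellichSum, h.gradientEnergy_eq hN0, h.rellichEnergy_eq hN0,
    h.hardyEnergy_eq hN0] at heq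
  exact (h.function_eq_zero_iff hN0).1
    (energyClosure.function_eq_zero_of_eq hN hγ hγ' hp heq.symm)

lemma gradientEnergy_pos (hN : 5 ≤ N) (hγ' : γ ≤ 0) (hp : p ∈ energyClosure N γ)
    (h : Represents γ p u G L) (hu : ¬ u =ᵐ[volume] 0) : 0 < gradientEnergy γ G := by
  have hN0 : N ≠ 0 := by omega
  have hN' : (5 : ℝ) ≤ N := by exact_mod_cast hN
  have h1 : 0 < ‖p.2.2‖ := norm_pos_iff.2 fun h0 => hu ((h.function_eq_zero_iff hN0).1 h0)
  have h2 : 0 < ((N : ℝ) - 4 - γ) / 2 := by linarith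
  rw [h.gradientEnergy_eq hN0]
  exact lt_of_lt_of_le (by positivity) (energyClosure.hardy_le hN0 hp)

lemma hardyRellichConst_le_div (hN : 5 ≤ N) (hγ : -2 < γ) (hγ' : γ ≤ 0)
    (hp : p ∈ energyClosure N γ) (h : Represents γ p u G L) (hu : ¬ u =ᵐ[volume] 0) :
    hardyRellichConst N γ ≤ hardyRellichSum γ u L / gradientEnergy γ G :=
  (le_div_iff₀ (h.gradientEnergy_pos hN hγ' hp hu)).2 (h.hardyRellich_le hN hγ hγ' hp)

end Represents

namespace IsTestFun

variable {γ : ℝ} {φ : RN N → ℝ}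

lemma not_ae_eq_zero (hφ : IsTestFun φ) (h0 : φ ≠ 0) : ¬ φ =ᵐ[volume] 0 := fun h =>
  h0 ((hφ.1.continuous.ae_eq_iff_eq volume continuous_const).1 h)

lemma memD22 (hφ : IsTestFun φ) : MemD22 γ φ := by
  refine ⟨hφ.1.continuous.locallyIntegrable, fun _ => φ, fun _ => hφ,
    fun ε hε => ⟨0, fun m _ n _ => ?_⟩, fun K _ => by simp⟩
  have h : ∀ x, Laplacian.laplacian (0 : RN N → ℝ) x = 0 := fun x =>
    eventuallyEq_zero_laplacian EventuallyEq.rfl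
  simpa [weightedLaplacianNorm, h] using hε

end IsTestFun

lemma exists_isTestFun_div_le (hN : 5 ≤ N) {γ : ℝ} (hγ' : γ ≤ 0) {ε : ℝ}
    (hε : 0 < ε) : ∃ φ : RN N → ℝ, IsTestFun φ ∧ φ ≠ 0 ∧
      hardyRellichSum γ φ (Laplacian.laplacian φ) / gradientEnergy γ (gradient φ) ≤
        hardyRellichConst N γ + ε := by
  obtain ⟨φ, hφ, h0, hle⟩ := PuncturedSmooth.exists_nearly_optimal hN hγ' hε
  obtain ⟨p, hp⟩ := hφ.1.exists_represents (γ := γ) hN hγ'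
  exact ⟨φ, hφ.1, h0, (div_le_iff₀ (hp.gradientEnergy_pos hN hγ'
    (hφ.1.mem_energyClosure hN hγ' hp) (hφ.1.not_ae_eq_zero h0))).2 hle⟩

end

theorem mainTheorem8 (N : ℕ) (hN : 5 ≤ N) (γ : ℝ) (hγ : -2 < γ) (hγ' : γ ≤ 0) :
    -- all terms are well defined and finite, the inequality holds, strictly if `u` is nonzero
    (∀ u : RN N → ℝ, MemD22 γ u →
      (∃ G : RN N → RN N, HasWeakGradient u G) ∧
      (∃ L : RN N → ℝ, HasWeakLaplacian u L) ∧
      ∀ (G : RN N → RN N) (L : RN N → ℝ), HasWeakGradient u G → HasWeakLaplacian u L →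
        Integrable (fun x => ‖x‖ ^ (-γ) * (L x) ^ 2) ∧
        Integrable (fun x => ‖x‖ ^ (-γ - 2) * ‖G x‖ ^ 2) ∧
        Integrable (fun x => ‖x‖ ^ (-γ - 4) * (u x) ^ 2) ∧
        hardyRellichSum γ u L ≥ hardyRellichConst N γ * gradientEnergy γ G ∧
        (¬ u =ᵐ[volume] 0 →
          hardyRellichSum γ u L > hardyRellichConst N γ * gradientEnergy γ G)) ∧
    -- the constant is sharp in the completion
    IsGLB {q : ℝ | ∃ (u : RN N → ℝ) (G : RN N → RN N) (L : RN N → ℝ),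
        MemD22 γ u ∧ HasWeakGradient u G ∧ HasWeakLaplacian u L ∧ ¬ u =ᵐ[volume] 0 ∧
        q = hardyRellichSum γ u L / gradientEnergy γ G}
      (hardyRellichConst N γ) ∧
    -- and already among the nonzero test functions
    IsGLB {q : ℝ | ∃ u : RN N → ℝ, IsTestFun u ∧ u ≠ 0 ∧
        q = hardyRellichSum γ u (Laplacian.laplacian u) / gradientEnergy γ (gradient u)}
      (hardyRellichConst N γ) := by
  have hN0 : N ≠ 0 := by omega
  -- by uniqueness of weak derivatives, any weak gradient and Laplacian of `u` are the `L²` limits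
  have hrep : ∀ {u : RN N → ℝ} {G : RN N → RN N} {L : RN N → ℝ}, MemD22 γ u →
      HasWeakGradient u G → HasWeakLaplacian u L →
      ∃ p ∈ energyClosure N γ, Represents γ p u G L := by
    intro u G L hu hG hL
    obtain ⟨p, hp, G₀, L₀, hr⟩ := hu.exists_represents hN hγ hγ'
    exact ⟨p, hp, hr.congr (EventuallyEq.refl _ _) (hG.ae_eq (hr.hasWeakGradient hN hγ hp))
      (hL.ae_eq (hr.hasWeakLaplacian hN hγ hp))⟩
  refine ⟨fun u hu => ?_, ⟨?_, fun c hc => ?_⟩, ⟨?_, fun c hc => ?_⟩⟩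
  · obtain ⟨p, hp, G₀, L₀, hr⟩ := hu.exists_represents hN hγ hγ'
    refine ⟨⟨G₀, hr.hasWeakGradient hN hγ hp⟩, ⟨L₀, hr.hasWeakLaplacian hN hγ hp⟩,
      fun G L hG hL => ?_⟩
    obtain ⟨q, hq, hr⟩ := hrep hu hG hL
    exact ⟨hr.integrable_rellich hN0, hr.integrable_gradient hN0, hr.integrable_hardy hN0,
      hr.hardyRellich_le hN hγ hγ' hq, hr.hardyRellich_lt hN hγ hγ' hq⟩
  · rintro _ ⟨u, G, L, hu, hG, hL, h0, rfl⟩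
    obtain ⟨q, hq, hr⟩ := hrep hu hG hL
    exact hr.hardyRellichConst_le_div hN hγ hγ' hq h0
  · refine le_of_forall_pos_le_add fun ε hε => ?_
    obtain ⟨φ, hφ, h0, hle⟩ := exists_isTestFun_div_le hN hγ' hε
    obtain ⟨p, hp⟩ := hφ.exists_represents (γ := γ) hN hγ'
    have hpm := hφ.mem_energyClosure hN hγ' hp
    exact (hc ⟨φ, _, _, hφ.memD22, hp.hasWeakGradient hN hγ hpm, hp.hasWeakLaplacian hN hγ hpm,
      hφ.not_ae_eq_zero h0, rfl⟩).trans hle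
  · rintro _ ⟨φ, hφ, h0, rfl⟩
    obtain ⟨p, hp⟩ := hφ.exists_represents (γ := γ) hN hγ'
    exact hp.hardyRellichConst_le_div hN hγ hγ' (hφ.mem_energyClosure hN hγ' hp)
      (hφ.not_ae_eq_zero h0)
  · refine le_of_forall_pos_le_add fun ε hε => ?_
    obtain ⟨φ, hφ, h0, hle⟩ := exists_isTestFun_div_le hN hγ' hε
    exact (hc ⟨φ, hφ, h0, rfl⟩).trans hle
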